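/- **Setting.** Let $\Omega,\Lambda\subset\mathbb R^d$ be bounded convex sets, $\Omega$ open, with $\mathcal L^d(\Omega)=\mathcal L^d(\Lambda)$, and let $r^*>1$ be such that $B(0,1/r^*)\subset\Lambda\subset B(0,r^*/2)$. Let $p\in(1,\infty)$ and $1/p+1/q=1$. Matrices carry the Frobenius inner product and norm, $\operatorname{div}$ of a matrix field is taken row by row, and $f^*(\xi^*)=\sup_\xi\{\xi\cdot\xi^*-f(\xi)\}$ is the Legendre transform. Let $S\subset W_0^{1,q}(\Omega,\mathbb R^{d\times d})$ be non-empty, closed and convex with finite-dimensional span. Assume: * (A1) $f:\mathbb R^{d\times d}\to\mathbb R$ is convex; there are $a,b,c>0$ with $c|\xi|^p/p+b\ge f(\xi)\ge a|\xi|-b$ for all $\xi$ and $|\xi^*|^q\le c|\xi|^p+b$ for all $\xi^*\in\partial f(\xi)$; some $\varphi\in S$ has $\int_\Omega f^*(\varphi)$ finite; and either $f$ is strictly convex, or for every $x^*$ with $f^*(x^*)<\infty$ the set $\partial f^*(x^*)$ is non-empty and its element of least norm is $0$. * (A3) $F\in L^1(\Omega;\mathbb R^d)$. * (ND)$_S$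 For every $\varphi\in S$ the map $F+\operatorname{div}\varphi$ is non-degenerate: $\{x\in\Omega: F(x)+\operatorname{div}\varphi(x)\in N\}$ is Lebesgue null for every Lebesgue null set $N\subset\mathbb R^d$. **Primal problem.** For measurable $u:\Omega\to\bar\Lambda$ put $V_S^f(u)=\sup_{\varphi\in S}\int_\Omega(-u\cdot\operatorname{div}\varphi-f^*(\varphi))\,dx$, and let $\Phi_S(u)$ be the set of maximizers. Let $\mathcal U_S$ be the set of measurable $u:\Omega\to\bar\Lambda$ for which there is $\bar c>0$ with $|\int_\Omega u\cdot\operatorname{div}\varphi|\le\bar c\|\varphi\|_{L^q}$ for all $\varphi\in S$, and let $\mathcal U_S^1$ be the set of $u\in\mathcal U_S$ with $\int_\Omega l(u(x))\,dx=\int_\Lambda l(y)\,dy$ for all $l\in C_c(\mathbb R^d)$. The primal problem is $$\inf_{u\in\mathcal U_S^1} I_0(u),\qquad I_0(u)=V_S^f(u)-\int_\Omega F\cdot u\,dx .$$ **Dual problem.** Let $\mathcal A$ be the set of triples $(k,l,\varphi)$ with $\varphi\in S$ and $k,l:\mathbb R^d\to\mathbb R\cup\{\infty\}$ Borel, each finite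 at some point, $l=\infty$ on $\mathbb R^d\setminus\bar\Lambda$, and $k(v)+l(u)\ge u\cdot v$ for all $u,v\in\mathbb R^d$. The dual problem is $$\inf_{(k,l,\varphi)\in\mathcal A}J(k,l,\varphi),\qquad J(k,l,\varphi)=\int_\Omega k(F+\operatorname{div}\varphi)\,dx+\int_\Lambda l(y)\,dy+\int_\Omega f^*(\varphi)\,dx .$$ Let $\mathcal A_0$ be the set of $(k,l,\varphi)$ with $\varphi\in S$, $k:\mathbb R^d\to\mathbb R$ Borel, $l\in C(\bar\Lambda;\mathbb R)$, $\inf_\Lambda l=0$ and $k(v)+l(u)\ge u\cdot v$ for all $u\in\Lambda$, $v\in\mathbb R^d$. Write $l^\&(v)=\sup_{u\in\bar\Lambda}\{u\cdot v-l(u)\}$ for $v\in\mathbb R^d$ and $k_\&(u)=\sup_{v\in\mathbb R^d}\{u\cdot v-k(v)\}$ for $u\in\bar\Lambda$. **Theorem.** 1. The two problems are dual: $\inf_{\mathcal U_S^1}I_0=-\inf_{\mathcal A}J=-\inf_{\mathcal A_0}J$, and this value is a real number. 2. There are an optimizer $(k_0,l_0,\varphi_0)$ of the dual problem over $\mathcal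 A$ and a minimizer $u_0$ of the primal problem such that $k_0:\mathbb R^d\to\mathbb R$ is convex and $r^*$-Lipschitz, $k_0=l_0^\&$ on $\mathbb R^d$, $l_0=(k_0)_\&$ on $\bar\Lambda$, for almost every $x\in\Omega$ the function $k_0$ is differentiable at $F(x)+\operatorname{div}\varphi_0(x)$ with $$u_0(x)=\nabla k_0\big(F(x)+\operatorname{div}\varphi_0(x)\big),$$ and $\varphi_0\in\Phi_S(u_0)$. 3. $u_0$ is, up to equality almost everywhere in $\Omega$, the only minimizer of the primal problem. -/

import Mathlib

open MeasureTheory Set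
open scoped ENNReal RealInnerProductSpace

noncomputable section

/-- `ℝ^d` with its Euclidean structure. -/
abbrev Vec (d : ℕ) : Type := EuclideanSpace ℝ (Fin d)

/-- `ℝ^{d×d}` with the Frobenius inner product and norm; the entry of `ξ` in row `i` and column `j`
is `ξ (i, j)`. -/
abbrev Mat (d : ℕ) : Type := EuclideanSpace ℝ (Fin d × Fin d)

/-! ### Extended-valued integrals and convex analysis -/

/-- The integral of an extended-real-valued function: integral of the positive part minus integral
of the negative part. (It is only used for functions having one of the two parts integrable.) -/
def eint {X : Type*} [MeasurableSpace X] (μ : Measure X) (g : X → EReal) : EReal :=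
  ((∫⁻ x, (g x).toENNReal ∂μ : ℝ≥0∞) : EReal) - ((∫⁻ x, (-g x).toENNReal ∂μ : ℝ≥0∞) : EReal)

/-- The Legendre transform `f*(ξ*) = sup_ξ (ξ·ξ* - f(ξ))`. -/
def legendre {E : Type*} [NormedAddCommGroup E] [InnerProductSpace ℝ E] (f : E → ℝ) (y : E) :
    EReal :=
  ⨆ x : E, ((⟪x, y⟫ - f x : ℝ) : EReal)

/-- The effective domain of an extended-real-valued function. -/
def effDom {E : Type*} (h : E → EReal) : Set E := {x | h x < ⊤}

/-- The subdifferential of `h` at `x`. -/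
def subdiff {E : Type*} [NormedAddCommGroup E] [InnerProductSpace ℝ E] (h : E → EReal) (x : E) :
    Set E :=
  {y | ∀ z, h x + ((⟪y, z - x⟫ : ℝ) : EReal) ≤ h z}

/-- `y` is the element of minimal norm of the subdifferential of `h` at `x`, that is,
`∂h(x) ≠ ∅` and `y = grad[h](x)`. -/
def IsGrad {E : Type*} [NormedAddCommGroup E] [InnerProductSpace ℝ E] (h : E → EReal) (x y : E) :
    Prop :=
  y ∈ subdiff h x ∧ ∀ z ∈ subdiff h x, ‖y‖ ≤ ‖z‖

/-! ### The Sobolev space `W_0^{1,q}(Ω; ℝ^{d×d})` -/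

/-- Pairs `(φ, Dφ)` in `L^q(Ω; ℝ^{d×d}) × L^q(Ω; L(ℝ^d, ℝ^{d×d}))`. An element of the Sobolev space
`W^{1,q}(Ω; ℝ^{d×d})` is identified with the pair formed by the map and its weak derivative; the
norm of the product induces a norm equivalent to the usual Sobolev norm. -/
abbrev SobolevPair (d : ℕ) (Ω : Set (Vec d)) (q : ℝ) : Type :=
  Lp (Mat d) (ENNReal.ofReal q) (volume.restrict Ω) ×
    Lp (Vec d →L[ℝ] Mat d) (ENNReal.ofReal q) (volume.restrict Ω)

/-- The pairs `(φ, Dφ)` with `φ ∈ C_c^∞(Ω; ℝ^{d×d})`. -/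
def testPairs (d : ℕ) (Ω : Set (Vec d)) (q : ℝ) : Set (SobolevPair d Ω q) :=
  {P | ∃ φ : Vec d → Mat d, ContDiff ℝ (⊤ : ℕ∞) φ ∧ HasCompactSupport φ ∧ tsupport φ ⊆ Ω ∧
    P.1 =ᵐ[volume.restrict Ω] φ ∧ P.2 =ᵐ[volume.restrict Ω] fderiv ℝ φ}

/-- `W_0^{1,q}(Ω; ℝ^{d×d})`: the closure of `C_c^∞(Ω; ℝ^{d×d})` in the Sobolev norm. The second
component of each of its elements is the weak derivative of the first one. -/
def W0 (d : ℕ) (Ω : Set (Vec d)) (q : ℝ) [Fact (1 ≤ ENNReal.ofReal q)] :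
    Set (SobolevPair d Ω q) :=
  closure (testPairs d Ω q)

/-- The row-wise divergence `(div φ)_i = ∑_j ∂_j φ_{ij}`. -/
def wdiv {d : ℕ} {Ω : Set (Vec d)} {q : ℝ} (φ : SobolevPair d Ω q) (x : Vec d) : Vec d :=
  WithLp.toLp 2 fun i => ∑ j : Fin d, (φ.2 x (EuclideanSpace.single j 1)) (i, j)

/-! ### Assumptions -/

/-- `𝒮_f`: the elements `φ` of `S` such that `∫_Ω f*(φ)` is finite. -/
def finitePart {d : ℕ} {Ω : Set (Vec d)} {q : ℝ} (f : Mat d → ℝ) (S : Set (SobolevPair d Ω q)) :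
    Set (SobolevPair d Ω q) :=
  {φ | φ ∈ S ∧ eint (volume.restrict Ω) (fun x => legendre f (φ.1 x)) ≠ ⊤ ∧
    eint (volume.restrict Ω) (fun x => legendre f (φ.1 x)) ≠ ⊥}

/-- The hypotheses on the integrand `f` (and its relation to `S`). -/
structure IntegrandAssumption {d : ℕ} {Ω : Set (Vec d)} (p q : ℝ) (f : Mat d → ℝ)
    (S : Set (SobolevPair d Ω q)) : Prop where
  convex : ConvexOn ℝ univ f
  growth : ∃ a b c : ℝ, 0 < a ∧ 0 < b ∧ 0 < c ∧
    (∀ ξ, f ξ ≤ c * ‖ξ‖ ^ p / p + b ∧ a * ‖ξ‖ - b ≤ f ξ) ∧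
    (∀ ξ, ∀ ζ ∈ subdiff (fun z => (f z : EReal)) ξ, ‖ζ‖ ^ q ≤ c * ‖ξ‖ ^ p + b)
  nonempty : (finitePart f S).Nonempty
  strict_or : StrictConvexOn ℝ univ f ∨ ∀ y ∈ effDom (legendre f), IsGrad (legendre f) y 0

/-- A map `G` on `Ω` is non-degenerate if preimages of Lebesgue null sets are Lebesgue null. -/
def Nondegenerate {d : ℕ} (Ω : Set (Vec d)) (G : Vec d → Vec d) : Prop :=
  ∀ N : Set (Vec d), volume N = 0 → volume (Ω ∩ G ⁻¹' N) = 0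

/-! ### The primal problem -/

/-- `𝒰_S`: measurable maps `u : Ω → Λ̄` with `|∫_Ω u·div φ| ≤ c ‖φ‖_{L^q}` for all `φ ∈ S`. -/
def US {d : ℕ} {Ω : Set (Vec d)} {q : ℝ} (Λ : Set (Vec d)) (S : Set (SobolevPair d Ω q)) :
    Set (Vec d → Vec d) :=
  {u | AEMeasurable u (volume.restrict Ω) ∧ (∀ᵐ x ∂volume.restrict Ω, u x ∈ closure Λ) ∧
    ∃ c : ℝ, 0 < c ∧ ∀ φ ∈ S, |∫ x in Ω, ⟪u x, wdiv φ x⟫| ≤ c * ‖φ.1‖}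

/-- `𝒰_S^1`: the measure-preserving elements of `𝒰_S`. -/
def US1 {d : ℕ} {Ω : Set (Vec d)} {q : ℝ} (Λ : Set (Vec d)) (S : Set (SobolevPair d Ω q)) :
    Set (Vec d → Vec d) :=
  {u | u ∈ US Λ S ∧ ∀ l : Vec d → ℝ, Continuous l → HasCompactSupport l →
    ∫ x in Ω, l (u x) = ∫ y in Λ, l y}

/-- `∫_Ω (-u·div φ - f*(φ)) ∈ [-∞, ∞)`. -/
def pairing {d : ℕ} {Ω : Set (Vec d)} {q : ℝ} (f : Mat d → ℝ) (u : Vec d → Vec d)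
    (φ : SobolevPair d Ω q) : EReal :=
  eint (volume.restrict Ω) (fun x => ((-⟪u x, wdiv φ x⟫ : ℝ) : EReal) - legendre f (φ.1 x))

/-- `V_S^f(u) = sup_{φ ∈ S} ∫_Ω (-u·div φ - f*(φ))`. -/
def VS {d : ℕ} {Ω : Set (Vec d)} {q : ℝ} (f : Mat d → ℝ) (S : Set (SobolevPair d Ω q))
    (u : Vec d → Vec d) : EReal :=
  ⨆ φ ∈ S, pairing f u φ

/-- `Φ_S(u)`: the set of maximizers in the definition of `V_S^f(u)`. -/
def PhiS {d : ℕ} {Ω : Set (Vec d)} {q : ℝ} (f : Mat d → ℝ) (S : Set (SobolevPair d Ω q))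
    (u : Vec d → Vec d) : Set (SobolevPair d Ω q) :=
  {φ | φ ∈ S ∧ ∀ ψ ∈ S, pairing f u ψ ≤ pairing f u φ}

/-- The primal functional `I_0(u) = V_S^f(u) - ∫_Ω F·u`. -/
def I0 {d : ℕ} {Ω : Set (Vec d)} {q : ℝ} (f : Mat d → ℝ) (F : Vec d → Vec d)
    (S : Set (SobolevPair d Ω q)) (u : Vec d → Vec d) : EReal :=
  VS f S u - ((∫ x in Ω, ⟪F x, u x⟫ : ℝ) : EReal)

/-! ### The dual problem -/

/-- `l^&(v) = sup_{u ∈ Λ̄} (u·v - l(u))`. -/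
def conjUp {d : ℕ} (Λ : Set (Vec d)) (l : Vec d → EReal) (v : Vec d) : EReal :=
  ⨆ u ∈ closure Λ, ((⟪u, v⟫ : ℝ) : EReal) - l u

/-- `k_&(u) = sup_{v ∈ ℝ^d} (u·v - k(v))`. -/
def conjDown {d : ℕ} (k : Vec d → EReal) (u : Vec d) : EReal :=
  ⨆ v : Vec d, ((⟪u, v⟫ : ℝ) : EReal) - k v

/-- The dual functional `J(k,l,φ) = ∫_Ω k(F + div φ) + ∫_Λ l + ∫_Ω f*(φ)`. -/
def J {d : ℕ} {Ω : Set (Vec d)} {q : ℝ} (Λ : Set (Vec d)) (f : Mat d → ℝ) (F : Vec d → Vec d)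
    (k l : Vec d → EReal) (φ : SobolevPair d Ω q) : EReal :=
  eint (volume.restrict Ω) (fun x => k (F x + wdiv φ x)) + eint (volume.restrict Λ) l
    + eint (volume.restrict Ω) (fun x => legendre f (φ.1 x))

/-- The admissible potentials: Borel functions `k, l : ℝ^d → ℝ ∪ {∞}`, each finite at some point,
with `l = ∞` off `Λ̄` and `k(v) + l(u) ≥ u·v` for all `u, v`. -/
structure Admissible {d : ℕ} (Λ : Set (Vec d)) (k l : Vec d → EReal) : Prop where
  measurable_k : Measurable k
  measurable_l : Measurable l
  k_ne_bot : ∀ v, k v ≠ ⊥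
  l_ne_bot : ∀ u, l u ≠ ⊥
  k_finite : ∃ v, k v ≠ ⊤
  l_finite : ∃ u, l u ≠ ⊤
  l_top : ∀ u, u ∉ closure Λ → l u = ⊤
  ineq : ∀ u v, ((⟪u, v⟫ : ℝ) : EReal) ≤ k v + l u

/-- The admissible potentials that are real-valued, with `l` continuous on `Λ̄` and normalized by
`inf_Λ l = 0`. -/
structure ContAdmissible {d : ℕ} (Λ : Set (Vec d)) (k l : Vec d → ℝ) : Prop where
  measurable_k : Measurable k
  continuous_l : ContinuousOn l (closure Λ)
  normalized : IsGLB (l '' Λ) 0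
  ineq : ∀ u ∈ Λ, ∀ v, ⟪u, v⟫ ≤ k v + l u

end

/-! Everything is read off from one minimizer of the dual problem. Write R for r*. Replacing (k, l)
by l^& and (l^&)_&, and then normalizing l^&(0) = 0 by a shift, does not increase J; the shift
cancels because Ω and Λ have equal volume. So only R-Lipschitz potentials κ with κ(0) = 0 have to
compete (`Admissible.exists_isConjUp_J_le`). On these J is coercive in φ: the κ-term loses at most R
times the L^1 norm of F + div φ, the transform f* is superlinear because f has p-growth, and on the
finite-dimensional span of S the Sobolev norm is controlled by the L^1 norm of φ. Compactness of
Lipschitz functions and of bounded parts of S, together with Fatou's lemma, then gives a minimizer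
(`exists_isDualOptimizer`).

At a minimizer (κ, κ_&, φ₀), Rademacher's theorem and non-degeneracy make κ differentiable at F +
div φ₀ almost everywhere; let u₀ be the gradient there. Two first variations make u₀ a primal
candidate. Perturbing l by tη changes l^&(v) by -tη(∇l^&(v)) to first order, so optimality says that
u₀ transports Lebesgue measure on Ω to that on Λ (`IsDualOptimizer.integral_comp_eq`). Moving φ₀
along segments of S gives φ₀ ∈ Φ_S(u₀) (`IsDualOptimizer.mem_PhiS`).

Weak duality is the inequality u·v ≤ k(v) + l(u), integrated along a measure-preserving u
(`US1.integral_inner_le`). Since κ(v) + κ_&(∇κ(v)) = v·∇κ(v), the map u₀ attains equality, so its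
primal value is minus the dual optimum (`IsDualOptimizer.I0_eq`). Any other primal minimizer must
attain equality almost everywhere, and where κ is differentiable only u = ∇κ(v) does so; hence
uniqueness (`IsDualOptimizer.ae_eq_of_I0_le`). Continuous potentials reach the same infimum:
restricting the supremum in κ_& to growing balls yields competitors whose dual values are bounded by
numbers tending to the optimum (`IsDualOptimizer.exists_contAdmissible`). -/

noncomputable section

open Filter Topology

/-! ### Integrals of extended-valued functions -/

section ExtendedIntegral

variable {X : Type*} [MeasurableSpace X] {μ : Measure X}

/-- An extended-valued function which is almost everywhere bounded below by an integrable one. -/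
def HasIntegrableMinorant (μ : Measure X) (g : X → EReal) : Prop :=
  ∃ h : X → ℝ, Integrable h μ ∧ ∀ᵐ x ∂μ, (h x : EReal) ≤ g x

lemma eint_mono {g h : X → EReal} (hgh : ∀ᵐ x ∂μ, g x ≤ h x) : eint μ g ≤ eint μ h := by
  refine EReal.sub_le_sub ?_ ?_
  · refine EReal.coe_ennreal_le_coe_ennreal_iff.2 (lintegral_mono_ae ?_)
    filter_upwards [hgh] with x hx using EReal.toENNReal_le_toENNReal hx
  · refine EReal.coe_ennreal_le_coe_ennreal_iff.2 (lintegral_mono_ae ?_)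
    filter_upwards [hgh] with x hx
    exact EReal.toENNReal_le_toENNReal (EReal.neg_le_neg_iff.2 hx)

lemma eint_congr {g h : X → EReal} (hgh : ∀ᵐ x ∂μ, g x = h x) : eint μ g = eint μ h :=
  le_antisymm (eint_mono (hgh.mono fun _ hx => hx.le)) (eint_mono (hgh.mono fun _ hx => hx.ge))

lemma eint_coe {g : X → ℝ} (hg : Integrable g μ) :
    eint μ (fun x => (g x : EReal)) = ((∫ x, g x ∂μ : ℝ) : EReal) := by
  have h1 : ∫⁻ x, ENNReal.ofReal (g x) ∂μ ≠ ⊤ := hg.lintegral_lt_top.ne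
  have h2 : ∫⁻ x, ENNReal.ofReal (-g x) ∂μ ≠ ⊤ := hg.neg.lintegral_lt_top.ne
  rw [integral_eq_lintegral_pos_part_sub_lintegral_neg_part hg, EReal.coe_sub]
  unfold eint
  simp only [← EReal.coe_neg, EReal.real_coe_toENNReal]
  rw [EReal.coe_ennreal_toReal h1, EReal.coe_ennreal_toReal h2]

namespace HasIntegrableMinorant

variable {g : X → EReal}

lemma of_integrable {h : X → ℝ} (hh : Integrable h μ) (hg : ∀ᵐ x ∂μ, (h x : EReal) ≤ g x) :
    HasIntegrableMinorant μ g := ⟨h, hh, hg⟩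

lemma bot_lt_eint (h : HasIntegrableMinorant μ g) : ⊥ < eint μ g := by
  obtain ⟨h, hh, hle⟩ := h
  have := eint_mono hle
  rw [eint_coe hh] at this
  exact (EReal.bot_lt_coe _).trans_le this

lemma lintegral_neg_lt_top (h : HasIntegrableMinorant μ g) :
    ∫⁻ x, (-g x).toENNReal ∂μ < ⊤ := by
  obtain ⟨h, hh, hle⟩ := h
  refine lt_of_le_of_lt (lintegral_mono_ae ?_) hh.neg.lintegral_lt_top
  filter_upwards [hle] with x hx
  have := EReal.toENNReal_le_toENNReal (EReal.neg_le_neg_iff.2 hx)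
  rwa [← EReal.coe_neg, EReal.real_coe_toENNReal] at this

/-- The minorant bounds the integral of the negative part, so a value other than `⊤` forces the
positive part to be integrable as well. This is the passage from `EReal` bookkeeping to Bochner
integrals. -/
lemma integrable_toReal (h : HasIntegrableMinorant μ g) (hg : AEMeasurable g μ)
    (htop : eint μ g ≠ ⊤) :
    Integrable (fun x => (g x).toReal) μ ∧ ∀ᵐ x ∂μ, (((g x).toReal : ℝ) : EReal) = g x := by
  have hneg := h.lintegral_neg_lt_top
  have hpos : ∫⁻ x, (g x).toENNReal ∂μ < ⊤ := by
    by_contra hcon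
    rw [not_lt, top_le_iff] at hcon
    apply htop
    unfold eint
    rw [hcon, EReal.coe_ennreal_top]
    exact EReal.top_sub (by simpa using hneg.ne)
  have h1 : ∀ᵐ x ∂μ, g x ≠ ⊤ := by
    filter_upwards [ae_lt_top' (measurable_ereal_toENNReal.comp_aemeasurable hg) hpos.ne] with x hx
    exact EReal.toENNReal_ne_top_iff.1 hx.ne
  have h2 : ∀ᵐ x ∂μ, g x ≠ ⊥ := by
    obtain ⟨h, -, hle⟩ := h
    filter_upwards [hle] with x hx
    exact ((EReal.bot_lt_coe _).trans_le hx).ne'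
  have h3 : ∀ᵐ x ∂μ, (((g x).toReal : ℝ) : EReal) = g x := by
    filter_upwards [h1, h2] with x a b using EReal.coe_toReal a b
  refine ⟨⟨(measurable_ereal_toReal.comp_aemeasurable hg).aestronglyMeasurable, ?_⟩, h3⟩
  have hle : ∫⁻ x, ‖(g x).toReal‖ₑ ∂μ ≤
      ∫⁻ x, (g x).toENNReal ∂μ + ∫⁻ x, (-g x).toENNReal ∂μ := by
    have hm : AEMeasurable (fun x => (g x).toENNReal) μ :=
      measurable_ereal_toENNReal.comp_aemeasurable hg
    rw [← lintegral_add_left' hm]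
    refine lintegral_mono_ae ?_
    filter_upwards [h3] with x hx
    rw [← hx, ← EReal.coe_neg, EReal.real_coe_toENNReal, EReal.real_coe_toENNReal,
      EReal.toReal_coe, Real.enorm_eq_ofReal_abs]
    rcases le_total 0 (g x).toReal with hs | hs
    · rw [abs_of_nonneg hs]; exact le_self_add
    · rw [abs_of_nonpos hs]; exact le_add_self
  exact hle.trans_lt (ENNReal.add_lt_top.2 ⟨hpos, hneg⟩)

lemma eint_eq_integral (h : HasIntegrableMinorant μ g) (hg : AEMeasurable g μ)
    (htop : eint μ g ≠ ⊤) : eint μ g = ((∫ x, (g x).toReal ∂μ : ℝ) : EReal) := by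
  obtain ⟨h1, h2⟩ := h.integrable_toReal hg htop
  rw [← eint_coe h1]
  exact eint_congr (h2.mono fun x hx => hx.symm)

lemma add_coe (h : HasIntegrableMinorant μ g) {w : X → ℝ} (hw : Integrable w μ) :
    HasIntegrableMinorant μ (fun x => g x + (w x : EReal)) := by
  obtain ⟨h, hh, hle⟩ := h
  refine ⟨fun x => h x + w x, hh.add hw, ?_⟩
  filter_upwards [hle] with x hx
  rw [EReal.coe_add]
  exact add_le_add_left hx _

lemma eint_add_coe (h : HasIntegrableMinorant μ g) (hg : AEMeasurable g μ) {w : X → ℝ}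
    (hw : Integrable w μ) :
    eint μ (fun x => g x + (w x : EReal)) = eint μ g + ((∫ x, w x ∂μ : ℝ) : EReal) := by
  have hgw : AEMeasurable (fun x => g x + (w x : EReal)) μ :=
    hg.add (measurable_coe_real_ereal.comp_aemeasurable hw.aemeasurable)
  have key : ∀ {a : X → EReal} {v : X → ℝ}, HasIntegrableMinorant μ a → AEMeasurable a μ →
      Integrable v μ → eint μ a ≠ ⊤ →
      eint μ (fun x => a x + (v x : EReal)) = eint μ a + ((∫ x, v x ∂μ : ℝ) : EReal) := by
    intro a v ha hma hv hat
    obtain ⟨h1, h2⟩ := ha.integrable_toReal hma hat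
    rw [ha.eint_eq_integral hma hat, ← EReal.coe_add, ← integral_add h1 hv]
    refine Eq.trans (eint_congr ?_) (eint_coe (h1.add hv))
    filter_upwards [h2] with x hx
    rw [EReal.coe_add, hx]
  by_cases ht : eint μ g = ⊤
  · rw [ht, EReal.top_add_coe]
    -- If the integral of g + w were not `⊤`, the finite case applied with -w would make the
    -- integral of g finite.
    by_contra hne
    have := key (h.add_coe hw) hgw hw.neg hne
    have h2 : eint μ (fun x => (g x + (w x : EReal)) + ((-w) x : ℝ)) = eint μ g := by
      refine eint_congr (Eventually.of_forall fun x => ?_)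
      rw [add_assoc, ← EReal.coe_add]
      simp
    rw [h2, ht] at this
    have h3 := (h.add_coe hw).eint_eq_integral hgw hne
    rw [h3, ← EReal.coe_add] at this
    exact EReal.coe_ne_top _ this.symm
  · exact key h hg hw ht

/-- The finite negative part rules out ∞ - ∞, the only obstruction to negating an `EReal`
difference. -/
lemma eint_neg (h : HasIntegrableMinorant μ g) : eint μ (fun x => -g x) = -eint μ g := by
  have hneg := h.lintegral_neg_lt_top
  unfold eint
  simp only [neg_neg]
  rw [EReal.neg_sub]
  · rw [sub_eq_add_neg, add_comm]
  · exact Or.inl (EReal.coe_ennreal_ne_bot _)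
  · right; simpa using hneg.ne

lemma eint_coe_sub (h : HasIntegrableMinorant μ g) (hg : AEMeasurable g μ) {w : X → ℝ}
    (hw : Integrable w μ) :
    eint μ (fun x => (w x : EReal) - g x) = ((∫ x, w x ∂μ : ℝ) : EReal) - eint μ g := by
  have h1 := (h.add_coe hw.neg).eint_neg
  rw [h.eint_add_coe hg hw.neg] at h1
  have h2 : ∀ x, -(g x + (((-w) x : ℝ) : EReal)) = (w x : EReal) - g x := by
    intro x
    rw [EReal.neg_add (Or.inr (EReal.coe_ne_top _)) (Or.inr (EReal.coe_ne_bot _)), Pi.neg_apply,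
      EReal.coe_neg, sub_eq_add_neg, neg_neg, add_comm, sub_eq_add_neg]
  simp only [h2] at h1
  rw [h1, EReal.neg_add (Or.inr (EReal.coe_ne_top _)) (Or.inr (EReal.coe_ne_bot _))]
  have : ∫ x, (-w) x ∂μ = -∫ x, w x ∂μ := integral_neg _
  rw [this, EReal.coe_neg, sub_eq_add_neg, neg_neg, add_comm, sub_eq_add_neg]

end HasIntegrableMinorant

lemma eint_of_nonneg {g : X → EReal} (hg : ∀ᵐ x ∂μ, 0 ≤ g x) :
    eint μ g = ((∫⁻ x, (g x).toENNReal ∂μ : ℝ≥0∞) : EReal) := by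
  unfold eint
  have : ∫⁻ x, (-g x).toENNReal ∂μ = 0 := by
    rw [lintegral_congr_ae (g := fun _ => 0), lintegral_zero]
    filter_upwards [hg] with x hx
    exact EReal.toENNReal_of_nonpos (by simpa using hx)
  rw [this]; simp

/-- Fatou's lemma in `ℝ≥0∞`, transported by the coercion to `EReal`, which is monotone and
continuous and so commutes with liminf. -/
lemma eint_le_liminf_of_nonneg {g : X → EReal} {gs : ℕ → X → EReal}
    (hgs : ∀ n, AEMeasurable (gs n) μ) (h0 : ∀ᵐ x ∂μ, 0 ≤ g x) (h0s : ∀ n, ∀ᵐ x ∂μ, 0 ≤ gs n x)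
    (hle : ∀ᵐ x ∂μ, g x ≤ liminf (fun n => gs n x) atTop) :
    eint μ g ≤ liminf (fun n => eint μ (gs n)) atTop := by
  have hcoe : ∀ v : ℕ → ℝ≥0∞, ((liminf v atTop : ℝ≥0∞) : EReal)
      = liminf (fun n => ((v n : ℝ≥0∞) : EReal)) atTop := fun v =>
    Monotone.map_liminf_of_continuousAt (f := fun x : ℝ≥0∞ => (x : EReal))
      (fun a b hab => EReal.coe_ennreal_le_coe_ennreal_iff.2 hab) v
      continuous_coe_ennreal_ereal.continuousAt
  rw [eint_of_nonneg h0]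
  simp only [fun n => eint_of_nonneg (h0s n)]
  rw [← hcoe, EReal.coe_ennreal_le_coe_ennreal_iff]
  refine le_trans (lintegral_mono_ae ?_)
    (lintegral_liminf_le' fun n => measurable_ereal_toENNReal.comp_aemeasurable (hgs n))
  filter_upwards [hle, h0, ae_all_iff.2 h0s] with x hx h0x h0sx
  rw [← EReal.coe_ennreal_le_coe_ennreal_iff, hcoe, EReal.coe_toENNReal h0x]
  simpa only [EReal.coe_toENNReal (h0sx _)] using hx

/-- Fatou's lemma for extended-valued functions with a common constant lower bound. -/
lemma eint_le_liminf [IsFiniteMeasure μ] {g : X → EReal} {gs : ℕ → X → EReal} (c : ℝ)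
    (hg : AEMeasurable g μ) (hgs : ∀ n, AEMeasurable (gs n) μ) (h0 : ∀ᵐ x ∂μ, (c : EReal) ≤ g x)
    (h0s : ∀ n, ∀ᵐ x ∂μ, (c : EReal) ≤ gs n x)
    (hle : ∀ᵐ x ∂μ, g x ≤ liminf (fun n => gs n x) atTop) :
    eint μ g ≤ liminf (fun n => eint μ (gs n)) atTop := by
  have hci : ∀ c : ℝ, Integrable (fun _ : X => c) μ := fun c => integrable_const c
  -- Adding -c reduces to the nonnegative case; the constant is integrable as the measure is finite,
  -- and is removed again at the end.
  have key : ∀ {a : X → EReal}, AEMeasurable a μ → (∀ᵐ x ∂μ, (c : EReal) ≤ a x) →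
      eint μ (fun x => a x + ((-c : ℝ) : EReal))
        = eint μ a + ((∫ _, -c ∂μ : ℝ) : EReal) := fun ha hc =>
    (HasIntegrableMinorant.of_integrable (hci c) hc).eint_add_coe ha (hci (-c))
  have hnn : ∀ {y : EReal}, (c : EReal) ≤ y → 0 ≤ y + ((-c : ℝ) : EReal) := by
    intro y hy
    have := add_le_add_left hy ((-c : ℝ) : EReal)
    rwa [← EReal.coe_add, add_neg_cancel, EReal.coe_zero] at this
  have hcont : ∀ s : ℝ, Continuous fun y : EReal => y + (s : EReal) := fun s =>
    continuous_iff_continuousAt.2 fun y =>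
      (EReal.continuousAt_add (p := (y, (s : EReal))) (Or.inr (EReal.coe_ne_bot s))
        (Or.inr (EReal.coe_ne_top s))).comp (f := fun y : EReal => (y, (s : EReal)))
        (by fun_prop)
  have hlim : ∀ (s : ℝ) (v : ℕ → EReal), liminf v atTop + (s : EReal)
      = liminf (fun n => v n + (s : EReal)) atTop := fun s v =>
    Monotone.map_liminf_of_continuousAt (f := fun y : EReal => y + (s : EReal))
      (fun a b hab => add_le_add_left hab _) v (hcont s).continuousAt
  have := eint_le_liminf_of_nonneg (μ := μ) (g := fun x => g x + ((-c : ℝ) : EReal))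
    (gs := fun n x => gs n x + ((-c : ℝ) : EReal))
    (fun n => (hgs n).add aemeasurable_const) (h0.mono fun x hx => hnn hx)
    (fun n => (h0s n).mono fun x hx => hnn hx)
    (hle.mono fun x hx => by
      rw [← hlim]
      exact add_le_add_left hx _)
  rw [key hg h0] at this
  simp only [fun n => key (hgs n) (h0s n)] at this
  rw [← hlim] at this
  have h2 := add_le_add_left this ((-(∫ _, -c ∂μ) : ℝ) : EReal)
  rwa [add_assoc, add_assoc, ← EReal.coe_add, add_neg_cancel, EReal.coe_zero, add_zero,
    add_zero] at h2

end ExtendedIntegral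

/-! ### Sobolev pairs -/

section LpToL1

variable {X : Type*} [MeasurableSpace X] (μ : Measure X) [IsFiniteMeasure μ]
  {E : Type*} [NormedAddCommGroup E] [NormedSpace ℝ E] (q : ℝ≥0∞) [hq : Fact (1 ≤ q)]

/-- The inclusion of `L^q` into `L^1` over a finite measure space. -/
def lpToL1 : Lp E q μ →L[ℝ] Lp E 1 μ :=
  LinearMap.mkContinuous
    { toFun := fun g => ⟨g.1, Lp.antitone hq.out g.2⟩
      map_add' := fun _ _ => rfl
      map_smul' := fun _ _ => rfl }
    (μ univ ^ (1 / (1 : ℝ≥0∞).toReal - 1 / q.toReal)).toReal (fun g => by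
      have h := eLpNorm_le_eLpNorm_mul_rpow_measure_univ (μ := μ) hq.out
        (Lp.aestronglyMeasurable g)
      have hexp : (0 : ℝ) ≤ 1 / (1 : ℝ≥0∞).toReal - 1 / q.toReal := by
        rcases eq_or_ne q ⊤ with rfl | hq'
        · simp
        · have : 1 ≤ q.toReal := by
            have := ENNReal.toReal_mono hq' hq.out
            simpa using this
          have := (div_le_one (by linarith)).2 this
          simp only [ENNReal.toReal_one, div_one]
          linarith
      have hfin : μ univ ^ (1 / (1 : ℝ≥0∞).toReal - 1 / q.toReal) ≠ ⊤ :=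
        ENNReal.rpow_ne_top_of_nonneg hexp (measure_ne_top μ univ)
      have h2 := ENNReal.toReal_mono (ENNReal.mul_ne_top (Lp.eLpNorm_ne_top g) hfin) h
      rw [ENNReal.toReal_mul, mul_comm] at h2
      exact h2)

variable {μ} in
/-- Integration of an `L^1` function against a bounded weight. -/
def weightedIntegral (w : X → ℝ) (hw : AEStronglyMeasurable w μ) (C : ℝ) (hC : ∀ x, ‖w x‖ ≤ C) :
    Lp E 1 μ →L[ℝ] E :=
  have hint : ∀ g : Lp E 1 μ, Integrable (fun x => w x • g x) μ := fun g =>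
    (L1.integrable_coeFn g).bdd_smul C hw (Eventually.of_forall hC)
  LinearMap.mkContinuous
    { toFun := fun g => ∫ x, w x • g x ∂μ
      map_add' := fun g h => by
        rw [← integral_add (hint g) (hint h)]
        refine integral_congr_ae ?_
        filter_upwards [Lp.coeFn_add g h] with x hx
        rw [hx, Pi.add_apply, smul_add]
      map_smul' := fun c g => by
        rw [RingHom.id_apply, ← integral_smul]
        refine integral_congr_ae ?_
        filter_upwards [Lp.coeFn_smul c g] with x hx
        rw [hx, Pi.smul_apply, smul_comm] }
    C (fun g => by
      rw [L1.norm_eq_integral_norm, ← integral_const_mul]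
      refine norm_integral_le_of_norm_le ((L1.integrable_coeFn g).norm.const_mul C) ?_
      refine Eventually.of_forall fun x => ?_
      rw [norm_smul]
      exact mul_le_mul_of_nonneg_right (hC x) (norm_nonneg _))

end LpToL1

section Sobolev

variable {d : ℕ} {Ω : Set (Vec d)} {q : ℝ}

/-- The row-wise trace, which maps a derivative to the divergence. -/
def rowTrace (d : ℕ) : (Vec d →L[ℝ] Mat d) →L[ℝ] Vec d :=
  LinearMap.toContinuousLinearMap
    { toFun := fun A => WithLp.toLp 2 fun i => ∑ j : Fin d, (A (EuclideanSpace.single j 1)) (i, j)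
      map_add' := fun A B => by
        ext i
        simp [Finset.sum_add_distrib]
      map_smul' := fun c A => by
        ext i
        simp [Finset.mul_sum] }

lemma wdiv_eq_rowTrace (φ : SobolevPair d Ω q) (x : Vec d) : wdiv φ x = rowTrace d (φ.2 x) := rfl

lemma wdiv_segment (φ ψ : SobolevPair d Ω q) (t : ℝ) :
    ∀ᵐ x ∂volume.restrict Ω,
      wdiv (φ + t • (ψ - φ)) x = wdiv φ x + t • (wdiv ψ x - wdiv φ x) := by
  filter_upwards [Lp.coeFn_add φ.2 (t • (ψ.2 - φ.2)), Lp.coeFn_smul t (ψ.2 - φ.2),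
    Lp.coeFn_sub ψ.2 φ.2] with x h1 h2 h3
  simp only [wdiv_eq_rowTrace, Prod.snd_add, Prod.smul_snd, Prod.snd_sub, h1, h2, h3,
    Pi.add_apply, Pi.smul_apply, Pi.sub_apply, map_add, map_smul, map_sub]

lemma fst_segment (φ ψ : SobolevPair d Ω q) (t : ℝ) :
    ∀ᵐ x ∂volume.restrict Ω, (φ + t • (ψ - φ)).1 x = φ.1 x + t • (ψ.1 x - φ.1 x) := by
  filter_upwards [Lp.coeFn_add φ.1 (t • (ψ.1 - φ.1)), Lp.coeFn_smul t (ψ.1 - φ.1),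
    Lp.coeFn_sub ψ.1 φ.1] with x h1 h2 h3
  simp only [Prod.fst_add, Prod.smul_fst, Prod.fst_sub, h1, h2, h3, Pi.add_apply, Pi.smul_apply,
    Pi.sub_apply]

variable [Fact (1 ≤ ENNReal.ofReal q)] [IsFiniteMeasure (volume.restrict Ω)]

/-- The divergence as a map into `L^1`. -/
def divL1 : SobolevPair d Ω q →L[ℝ] Lp (Vec d) 1 (volume.restrict Ω) :=
  ((lpToL1 (volume.restrict Ω) (ENNReal.ofReal q)).comp
    ((rowTrace d).compLpL (ENNReal.ofReal q) (volume.restrict Ω))).comp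
      (ContinuousLinearMap.snd ℝ _ _)

/-- The first component as an element of `L^1`. -/
def fstL1 : SobolevPair d Ω q →L[ℝ] Lp (Mat d) 1 (volume.restrict Ω) :=
  (lpToL1 (volume.restrict Ω) (ENNReal.ofReal q)).comp (ContinuousLinearMap.fst ℝ _ _)

lemma coeFn_divL1 (φ : SobolevPair d Ω q) : divL1 φ =ᵐ[volume.restrict Ω] wdiv φ :=
  ContinuousLinearMap.coeFn_compLpL (rowTrace d) φ.2

lemma coeFn_fstL1 (φ : SobolevPair d Ω q) : ⇑(fstL1 φ) = ⇑φ.1 := rfl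

lemma integrable_wdiv (φ : SobolevPair d Ω q) : Integrable (wdiv φ) (volume.restrict Ω) :=
  (L1.integrable_coeFn (divL1 φ)).congr (coeFn_divL1 φ)

lemma integrable_fst (φ : SobolevPair d Ω q) : Integrable φ.1 (volume.restrict Ω) :=
  L1.integrable_coeFn (fstL1 φ)

lemma integral_norm_wdiv (φ : SobolevPair d Ω q) : ∫ x in Ω, ‖wdiv φ x‖ = ‖divL1 φ‖ := by
  rw [L1.norm_eq_integral_norm]
  refine integral_congr_ae ?_
  filter_upwards [coeFn_divL1 φ] with x hx
  rw [hx]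

lemma integral_norm_fst (φ : SobolevPair d Ω q) : ∫ x in Ω, ‖φ.1 x‖ = ‖fstL1 φ‖ := by
  rw [L1.norm_eq_integral_norm, coeFn_fstL1]


/-- The defect in the integration by parts formula in direction `e` against the weight `ψ`. -/
def partsDefect (ψ : Vec d → ℝ) (hψ : ContDiff ℝ (⊤ : ℕ∞) ψ) (hc : HasCompactSupport ψ)
    (e : Vec d) : SobolevPair d Ω q →L[ℝ] Mat d :=
  have hψ' : Continuous fun x => fderiv ℝ ψ x e :=
    (hψ.continuous_fderiv (by simp)).clm_apply continuous_const
  have hc' : HasCompactSupport fun x => fderiv ℝ ψ x e := hc.fderiv_apply ℝ e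
  have B := hψ.continuous.bounded_above_of_compact_support hc
  have B' := hψ'.bounded_above_of_compact_support hc'
  ((weightedIntegral ψ hψ.continuous.aestronglyMeasurable B.choose B.choose_spec).comp
    ((lpToL1 (volume.restrict Ω) (ENNReal.ofReal q)).comp
      (((ContinuousLinearMap.apply ℝ (Mat d) e).compLpL (ENNReal.ofReal q)
        (volume.restrict Ω)).comp (ContinuousLinearMap.snd ℝ _ _)))) +
  (weightedIntegral (fun x => fderiv ℝ ψ x e) hψ'.aestronglyMeasurable
    B'.choose B'.choose_spec).comp fstL1

lemma partsDefect_apply (ψ : Vec d → ℝ) (hψ : ContDiff ℝ (⊤ : ℕ∞) ψ) (hc : HasCompactSupport ψ)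
    (e : Vec d) (P : SobolevPair d Ω q) :
    partsDefect ψ hψ hc e P
      = (∫ x in Ω, ψ x • P.2 x e) + ∫ x in Ω, (fderiv ℝ ψ x e) • P.1 x := by
  have : partsDefect ψ hψ hc e P
      = (∫ x in Ω, ψ x • ((ContinuousLinearMap.apply ℝ (Mat d) e).compLp P.2 x))
        + ∫ x in Ω, (fderiv ℝ ψ x e) • P.1 x := rfl
  rw [this]
  congr 1
  refine integral_congr_ae ?_
  filter_upwards [ContinuousLinearMap.coeFn_compLp (ContinuousLinearMap.apply ℝ (Mat d) e) P.2]
    with x hx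
  rw [hx]; rfl

/-- The support of φ lies in Ω, so both integrals extend to the whole space and there is no boundary
term. For the same reason ψ need not be supported in Ω. -/
lemma partsDefect_eq_zero_of_testPairs (ψ : Vec d → ℝ) (hψ : ContDiff ℝ (⊤ : ℕ∞) ψ)
    (hc : HasCompactSupport ψ) (e : Vec d) {P : SobolevPair d Ω q} (hP : P ∈ testPairs d Ω q) :
    partsDefect ψ hψ hc e P = 0 := by
  obtain ⟨φ, hφ, hφc, hφs, h1, h2⟩ := hP
  have hφ' : Continuous fun x => fderiv ℝ φ x e :=
    (hφ.continuous_fderiv (by simp)).clm_apply continuous_const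
  have hψ' : Continuous fun x => fderiv ℝ ψ x e :=
    (hψ.continuous_fderiv (by simp)).clm_apply continuous_const
  have hφ0 : ∀ x, x ∉ Ω → φ x = 0 := fun x hx => image_eq_zero_of_notMem_tsupport fun h => hx (hφs h)
  have hφ0' : ∀ x, x ∉ Ω → fderiv ℝ φ x e = 0 := fun x hx => by
    rw [image_eq_zero_of_notMem_tsupport (f := fderiv ℝ φ)
      (fun h => hx (hφs (tsupport_fderiv_subset ℝ h)))]
    rfl
  rw [partsDefect_apply, integral_congr_ae (g := fun x => ψ x • fderiv ℝ φ x e),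
    integral_congr_ae (f := fun x => fderiv ℝ ψ x e • P.1 x) (g := fun x => fderiv ℝ ψ x e • φ x),
    setIntegral_eq_integral_of_forall_compl_eq_zero,
    setIntegral_eq_integral_of_forall_compl_eq_zero,
    integral_smul_fderiv_eq_neg_fderiv_smul_of_integrable, neg_add_cancel]
  · exact (hψ'.smul hφ.continuous).integrable_of_hasCompactSupport hφc.smul_left
  · exact (hψ.continuous.smul hφ').integrable_of_hasCompactSupport hc.smul_right
  · exact (hψ.continuous.smul hφ.continuous).integrable_of_hasCompactSupport hφc.smul_left
  · exact fun x _ => (hψ.differentiable (by simp)).differentiableAt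
  · exact fun x _ => (hφ.differentiable (by simp)).differentiableAt
  · intro x hx; rw [hφ0 x hx, smul_zero]
  · intro x hx; rw [hφ0' x hx, smul_zero]
  · filter_upwards [h1] with x hx; rw [hx]
  · filter_upwards [h2] with x hx; rw [hx]

/-- The kernel of a continuous linear map is a closed subspace: it absorbs first the closure of the
test pairs, then the span. -/
lemma partsDefect_eq_zero_of_mem_span {S : Set (SobolevPair d Ω q)} (hS : S ⊆ W0 d Ω q)
    (ψ : Vec d → ℝ) (hψ : ContDiff ℝ (⊤ : ℕ∞) ψ) (hc : HasCompactSupport ψ) (e : Vec d)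
    {P : SobolevPair d Ω q} (hP : P ∈ Submodule.span ℝ S) : partsDefect ψ hψ hc e P = 0 := by
  have hcl : W0 d Ω q ⊆ (partsDefect (Ω := Ω) (q := q) ψ hψ hc e).ker :=
    closure_minimal (fun P hP => partsDefect_eq_zero_of_testPairs ψ hψ hc e hP)
      (partsDefect (Ω := Ω) (q := q) ψ hψ hc e).isClosed_ker
  exact Submodule.span_le.2 (hS.trans hcl) hP

/-- In the span of a subset of `W_0^{1,q}`, the weak derivative is determined by the map. -/
lemma eq_zero_of_fst_eq_zero {S : Set (SobolevPair d Ω q)} (hS : S ⊆ W0 d Ω q)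
    {P : SobolevPair d Ω q} (hP : P ∈ Submodule.span ℝ S) (h0 : P.1 = 0) : P = 0 := by
  have h1 : P.1 =ᵐ[volume.restrict Ω] 0 := by
    rw [h0]; exact Lp.coeFn_zero _ _ _
  have hint : Integrable P.2 (volume.restrict Ω) :=
    L1.integrable_coeFn (lpToL1 (volume.restrict Ω) (ENNReal.ofReal q) P.2)
  have key : ∀ e : Vec d, ∀ᵐ x ∂volume.restrict Ω, P.2 x e = 0 := by
    intro e
    -- With a vanishing first component, integration by parts says that the derivative is orthogonal
    -- to every test function.
    refine ae_eq_zero_of_integral_contDiff_smul_eq_zero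
      (hint.apply_continuousLinearMap e).locallyIntegrable ?_
    intro ψ hψ hc
    have h := partsDefect_eq_zero_of_mem_span hS ψ hψ hc e hP
    rw [partsDefect_apply, integral_congr_ae (f := fun x => fderiv ℝ ψ x e • P.1 x)
      (g := fun _ => 0), integral_zero, add_zero] at h
    · exact h
    · filter_upwards [h1] with x hx
      rw [hx, Pi.zero_apply, smul_zero]
  have h2 : P.2 = 0 := by
    rw [Lp.eq_zero_iff_ae_eq_zero]
    filter_upwards [ae_all_iff.2 fun j : Fin d => key (EuclideanSpace.single j 1)] with x hx
    refine ContinuousLinearMap.coe_injective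
      ((EuclideanSpace.basisFun (Fin d) ℝ).toBasis.ext fun j => ?_)
    simpa using hx j
  exact Prod.ext h0 h2

/-- On a finite-dimensional space spanned by a subset of `W_0^{1,q}`, the Sobolev norm is
controlled by the `L^1` norm of the map. -/
lemma exists_norm_le_integral_norm_fst {S : Set (SobolevPair d Ω q)} (hS : S ⊆ W0 d Ω q)
    [FiniteDimensional ℝ (Submodule.span ℝ S)] :
    ∃ C : ℝ, 0 < C ∧ ∀ P ∈ Submodule.span ℝ S, ‖P‖ ≤ C * ∫ x in Ω, ‖P.1 x‖ := by
  set T : Submodule.span ℝ S →ₗ[ℝ] Lp (Mat d) 1 (volume.restrict Ω) :=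
    (fstL1 (Ω := Ω) (q := q)).toLinearMap.domRestrict (Submodule.span ℝ S) with hT
  have hinj : Function.Injective T := by
    rw [injective_iff_map_eq_zero]
    intro P hP
    have hP' : fstL1 (P : SobolevPair d Ω q) = 0 := hP
    have h0 : (P : SobolevPair d Ω q).1 = 0 := by
      rw [Lp.eq_zero_iff_ae_eq_zero, ← coeFn_fstL1, hP']
      exact Lp.coeFn_zero _ _ _
    exact Subtype.ext (eq_zero_of_fst_eq_zero hS P.2 h0)
  -- In finite dimension an injective linear map is bounded below, which gives the constant.
  obtain ⟨K, hK, hanti⟩ := T.injective_iff_antilipschitz.1 hinj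
  refine ⟨K, hK, fun P hP => ?_⟩
  have := hanti.le_mul_dist ⟨P, hP⟩ 0
  rw [map_zero, dist_zero_right, dist_zero_right] at this
  rw [integral_norm_fst]
  exact this

end Sobolev

/-! ### Conjugate potentials -/

section Conjugates

variable {d : ℕ} {Λ : Set (Vec d)}

lemma lowerSemicontinuous_legendre {E : Type*} [NormedAddCommGroup E] [InnerProductSpace ℝ E]
    (f : E → ℝ) : LowerSemicontinuous (legendre f) :=
  lowerSemicontinuous_iSup fun x =>
    (continuous_coe_real_ereal.comp (f := fun y => ⟪x, y⟫ - f x) (by fun_prop)).lowerSemicontinuous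

lemma measurable_legendre {E : Type*} [NormedAddCommGroup E] [InnerProductSpace ℝ E]
    [MeasurableSpace E] [BorelSpace E] (f : E → ℝ) : Measurable (legendre f) :=
  (lowerSemicontinuous_legendre f).measurable

lemma le_legendre {E : Type*} [NormedAddCommGroup E] [InnerProductSpace ℝ E]
    (f : E → ℝ) (x y : E) : ((⟪x, y⟫ - f x : ℝ) : EReal) ≤ legendre f y :=
  le_iSup (fun x => ((⟪x, y⟫ - f x : ℝ) : EReal)) x

lemma neg_apply_zero_le_legendre {E : Type*} [NormedAddCommGroup E] [InnerProductSpace ℝ E]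
    (f : E → ℝ) (y : E) : ((-f 0 : ℝ) : EReal) ≤ legendre f y := by
  simpa using le_legendre f 0 y

lemma lowerSemicontinuous_conjDown (k : Vec d → ℝ) :
    LowerSemicontinuous (conjDown fun v => (k v : EReal)) :=
  lowerSemicontinuous_iSup fun v => by
    have : (fun u : Vec d => ((⟪u, v⟫ : ℝ) : EReal) - (k v : EReal))
        = fun u : Vec d => ((⟪u, v⟫ - k v : ℝ) : EReal) := by
      funext u; rw [EReal.coe_sub]
    rw [this]
    exact (continuous_coe_real_ereal.comp (f := fun u : Vec d => ⟪u, v⟫ - k v)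
      (by fun_prop)).lowerSemicontinuous

lemma measurable_conjDown (k : Vec d → ℝ) : Measurable (conjDown fun v => (k v : EReal)) :=
  (lowerSemicontinuous_conjDown k).measurable

lemma le_conjDown (k : Vec d → ℝ) (u v : Vec d) :
    ((⟪u, v⟫ - k v : ℝ) : EReal) ≤ conjDown (fun v => (k v : EReal)) u := by
  rw [EReal.coe_sub]
  exact le_iSup (fun v : Vec d => ((⟪u, v⟫ : ℝ) : EReal) - (k v : EReal)) v

lemma conjDown_le_iff {k : Vec d → ℝ} {u : Vec d} {c : EReal} :
    conjDown (fun v => (k v : EReal)) u ≤ c ↔ ∀ v, ((⟪u, v⟫ - k v : ℝ) : EReal) ≤ c := by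
  simp only [conjDown, iSup_le_iff, EReal.coe_sub]

lemma conjDown_ne_bot (k : Vec d → ℝ) (u : Vec d) : conjDown (fun v => (k v : EReal)) u ≠ ⊥ :=
  ((EReal.bot_lt_coe _).trans_le (le_conjDown k u 0)).ne'

lemma inner_le_add_conjDown (k : Vec d → ℝ) (u v : Vec d) :
    ((⟪u, v⟫ : ℝ) : EReal) ≤ k v + conjDown (fun v => (k v : EReal)) u := by
  have := add_le_add_right (le_conjDown k u v) (k v : EReal)
  rwa [← EReal.coe_add, add_sub_cancel] at this

/-- Trades the `EReal` subtraction in the conjugate for an addition, which is unambiguous as l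
avoids `⊥`. -/
lemma conjUp_le_coe_iff {l : Vec d → EReal} (hl : ∀ u, l u ≠ ⊥) {v : Vec d} {c : ℝ} :
    conjUp Λ l v ≤ c ↔ ∀ u ∈ closure Λ, ((⟪u, v⟫ : ℝ) : EReal) ≤ c + l u := by
  simp only [conjUp, iSup_le_iff]
  refine forall₂_congr fun u _ => ?_
  exact EReal.sub_le_iff_le_add (Or.inl (hl u)) (Or.inr (EReal.coe_ne_bot c))

/-- `κ` is the real-valued function `l^&`. -/
def IsConjUp (Λ : Set (Vec d)) (l : Vec d → EReal) (κ : Vec d → ℝ) : Prop :=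
  ∀ v, (κ v : EReal) = conjUp Λ l v

namespace IsConjUp

variable {l : Vec d → EReal} {κ : Vec d → ℝ}

lemma inner_le (h : IsConjUp Λ l κ) (hl : ∀ u, l u ≠ ⊥) {u : Vec d} (hu : u ∈ closure Λ)
    (v : Vec d) : ((⟪u, v⟫ : ℝ) : EReal) ≤ κ v + l u :=
  (conjUp_le_coe_iff hl).1 (h v).ge u hu

lemma le_of_forall (h : IsConjUp Λ l κ) (hl : ∀ u, l u ≠ ⊥) {v : Vec d} {c : ℝ}
    (hc : ∀ u ∈ closure Λ, ((⟪u, v⟫ : ℝ) : EReal) ≤ c + l u) : κ v ≤ c :=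
  EReal.coe_le_coe_iff.1 ((h v).le.trans ((conjUp_le_coe_iff hl).2 hc))

/-- A supremum of affine functions whose slopes u have norm at most R. -/
lemma le_add_mul (h : IsConjUp Λ l κ) (hl : ∀ u, l u ≠ ⊥) {R : ℝ}
    (hR : ∀ u ∈ closure Λ, ‖u‖ ≤ R) (v w : Vec d) : κ v ≤ κ w + R * ‖v - w‖ := by
  refine h.le_of_forall hl fun u hu => ?_
  have h1 := h.inner_le hl hu w
  have h2 : ⟪u, v⟫ ≤ ⟪u, w⟫ + R * ‖v - w‖ := by
    have h3 : ⟪u, v⟫ = ⟪u, w⟫ + ⟪u, v - w⟫ := by rw [inner_sub_right]; ring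
    rw [h3]
    have := (real_inner_le_norm u (v - w)).trans
      (mul_le_mul_of_nonneg_right (hR u hu) (norm_nonneg _))
    linarith
  have h4 := (EReal.coe_le_coe_iff.2 h2).trans
    ((EReal.coe_add _ _).le.trans (add_le_add_left h1 _))
  rwa [add_right_comm, ← EReal.coe_add] at h4

lemma lipschitzWith (h : IsConjUp Λ l κ) (hl : ∀ u, l u ≠ ⊥) {R : ℝ} (hR0 : 0 ≤ R)
    (hR : ∀ u ∈ closure Λ, ‖u‖ ≤ R) : LipschitzWith R.toNNReal κ :=
  LipschitzWith.of_le_add_mul _ fun v w => by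
    rw [Real.coe_toNNReal R hR0, dist_eq_norm]
    exact h.le_add_mul hl hR v w

lemma conjDown_le (h : IsConjUp Λ l κ) (hl : ∀ u, l u ≠ ⊥) {u : Vec d} (hu : u ∈ closure Λ) :
    conjDown (fun v => (κ v : EReal)) u ≤ l u := by
  rw [conjDown_le_iff]
  intro v
  have := add_le_add_left (h.inner_le hl hu v) ((-κ v : ℝ) : EReal)
  rwa [← EReal.coe_add, add_right_comm, ← EReal.coe_add, add_neg_cancel, EReal.coe_zero, zero_add,
    ← sub_eq_add_neg] at this

/-- Conjugating three times is conjugating once: κ_& ≤ l on the closure of Λ gives one inequality,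
the definition of κ_& the other. -/
lemma isConjUp_conjDown (h : IsConjUp Λ l κ) (hl : ∀ u, l u ≠ ⊥) :
    IsConjUp Λ (conjDown fun v => (κ v : EReal)) κ := by
  intro v
  refine le_antisymm ?_ ?_
  · rw [h v]
    exact iSup₂_mono fun u hu => EReal.sub_le_sub le_rfl (h.conjDown_le hl hu)
  · exact (conjUp_le_coe_iff (conjDown_ne_bot κ)).2 fun u _ => inner_le_add_conjDown κ u v

lemma shift (h : IsConjUp Λ l κ) (c : ℝ) :
    IsConjUp Λ (fun u => l u + (c : EReal)) (fun v => κ v - c) := by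
  have aux1 : ∀ (a : ℝ) (x : EReal), (a : EReal) - (x + c) = a - x - c := by
    intro a x
    induction x <;> norm_cast; simp [sub_sub]
  intro v
  refine le_antisymm ?_ ?_
  · have : (κ v : EReal) ≤ conjUp Λ (fun u => l u + (c : EReal)) v + c := by
      rw [h v]
      refine iSup₂_le fun u hu => ?_
      have h1 : ((⟪u, v⟫ : ℝ) : EReal) - (l u + c)
          ≤ conjUp Λ (fun u => l u + (c : EReal)) v :=
        le_iSup₂ (f := fun u (_ : u ∈ closure Λ) => ((⟪u, v⟫ : ℝ) : EReal) - (l u + c)) u hu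
      rw [aux1] at h1
      exact EReal.sub_le_iff_le_add (Or.inl (EReal.coe_ne_bot c)) (Or.inl (EReal.coe_ne_top c)) |>.1
        h1
    rw [EReal.coe_sub]
    exact (EReal.sub_le_iff_le_add (Or.inl (EReal.coe_ne_bot c))
      (Or.inl (EReal.coe_ne_top c))).2 this
  · refine iSup₂_le fun u hu => ?_
    rw [aux1, EReal.coe_sub]
    refine EReal.sub_le_sub ?_ le_rfl
    rw [h v]
    exact le_iSup₂ (f := fun u (_ : u ∈ closure Λ) => ((⟪u, v⟫ : ℝ) : EReal) - l u) u hu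

lemma convexOn (h : IsConjUp Λ l κ) (hl : ∀ u, l u ≠ ⊥) : ConvexOn ℝ univ κ := by
  refine ⟨convex_univ, fun v _ w _ a b ha hb hab => ?_⟩
  refine h.le_of_forall hl fun u hu => ?_
  have h1 := h.inner_le hl hu v
  have h2 := h.inner_le hl hu w
  rcases eq_or_ne (l u) ⊤ with ht | ht
  · rw [ht, EReal.coe_add_top]; exact le_top
  · rw [← EReal.coe_toReal ht (hl u), ← EReal.coe_add, EReal.coe_le_coe_iff] at h1 h2 ⊢
    rw [inner_add_right, inner_smul_right, inner_smul_right]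
    simp only [smul_eq_mul]
    have h3 : (l u).toReal = a * (l u).toReal + b * (l u).toReal := by
      rw [← add_mul, hab, one_mul]
    linarith [mul_le_mul_of_nonneg_left h1 ha, mul_le_mul_of_nonneg_left h2 hb]

end IsConjUp

/-- A point where l is finite bounds l^& below. A point v₁ where k is finite bounds it above at v₁,
and boundedness of Λ carries this to every v with linear growth. -/
lemma Admissible.exists_isConjUp {k l : Vec d → EReal} (h : Admissible Λ k l) {R : ℝ}
    (hR : ∀ u ∈ closure Λ, ‖u‖ ≤ R) : ∃ κ, IsConjUp Λ l κ := by
  obtain ⟨u₁, hu₁⟩ := h.l_finite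
  have hu₁c : u₁ ∈ closure Λ := by
    by_contra hc
    exact hu₁ (h.l_top u₁ hc)
  obtain ⟨v₁, hv₁⟩ := h.k_finite
  have hv : ∀ v, ∃ x : ℝ, (x : EReal) = conjUp Λ l v := by
    intro v
    have hlow : conjUp Λ l v ≠ ⊥ := by
      have h1 : ((⟪u₁, v⟫ : ℝ) : EReal) - l u₁ ≤ conjUp Λ l v :=
        le_iSup₂ (f := fun u (_ : u ∈ closure Λ) => ((⟪u, v⟫ : ℝ) : EReal) - l u) u₁ hu₁c
      rw [← EReal.coe_toReal hu₁ (h.l_ne_bot u₁), ← EReal.coe_sub] at h1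
      exact ((EReal.bot_lt_coe _).trans_le h1).ne'
    have hup : conjUp Λ l v ≠ ⊤ := by
      have h1 : conjUp Λ l v ≤ (((k v₁).toReal + R * ‖v - v₁‖ : ℝ) : EReal) := by
        rw [conjUp_le_coe_iff h.l_ne_bot]
        intro u hu
        have h3 := h.ineq u v₁
        rw [← EReal.coe_toReal hv₁ (h.k_ne_bot v₁)] at h3
        have h2 : ⟪u, v⟫ ≤ ⟪u, v₁⟫ + R * ‖v - v₁‖ := by
          have h3 : ⟪u, v⟫ = ⟪u, v₁⟫ + ⟪u, v - v₁⟫ := by rw [inner_sub_right]; ring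
          rw [h3]
          have := (real_inner_le_norm u (v - v₁)).trans
            (mul_le_mul_of_nonneg_right (hR u hu) (norm_nonneg _))
          linarith
        have h4 := (EReal.coe_le_coe_iff.2 h2).trans
          ((EReal.coe_add _ _).le.trans (add_le_add_left h3 _))
        rwa [add_right_comm, ← EReal.coe_add] at h4
      exact (h1.trans_lt (EReal.coe_lt_top _)).ne
    exact ⟨_, EReal.coe_toReal hup hlow⟩
  choose κ hκ using hv
  exact ⟨κ, hκ⟩

lemma IsConjUp.le_of_admissible {k l : Vec d → EReal} {κ : Vec d → ℝ} (hκ : IsConjUp Λ l κ)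
    (h : Admissible Λ k l) (v : Vec d) : (κ v : EReal) ≤ k v := by
  rw [hκ v]
  refine iSup₂_le fun u _ => ?_
  rcases eq_or_ne (k v) ⊤ with ht | ht
  · rw [ht]; exact le_top
  · exact (EReal.sub_le_iff_le_add (Or.inl (h.l_ne_bot u)) (Or.inr (h.k_ne_bot v))).2 (h.ineq u v)

open Classical in
/-- The function `k_&` on `Λ̄`, extended by `∞`. -/
def extDown (Λ : Set (Vec d)) (k : Vec d → ℝ) (u : Vec d) : EReal :=
  if u ∈ closure Λ then conjDown (fun v => (k v : EReal)) u else ⊤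

lemma extDown_of_mem {k : Vec d → ℝ} {u : Vec d} (hu : u ∈ closure Λ) :
    extDown Λ k u = conjDown (fun v => (k v : EReal)) u := if_pos hu

lemma extDown_of_notMem {k : Vec d → ℝ} {u : Vec d} (hu : u ∉ closure Λ) :
    extDown Λ k u = ⊤ := if_neg hu

lemma extDown_ne_bot (k : Vec d → ℝ) (u : Vec d) : extDown Λ k u ≠ ⊥ := by
  by_cases hu : u ∈ closure Λ
  · rw [extDown_of_mem hu]; exact conjDown_ne_bot k u
  · rw [extDown_of_notMem hu]; exact top_ne_bot

lemma conjUp_extDown (k : Vec d → ℝ) (v : Vec d) :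
    conjUp Λ (extDown Λ k) v = conjUp Λ (conjDown fun v => (k v : EReal)) v :=
  iSup_congr fun u => iSup_congr fun hu => by rw [extDown_of_mem hu]

lemma admissible_extDown {k : Vec d → ℝ} (hk : Measurable k)
    (hfin : ∃ u ∈ closure Λ, conjDown (fun v => (k v : EReal)) u ≠ ⊤) :
    Admissible Λ (fun v => (k v : EReal)) (extDown Λ k) where
  measurable_k := measurable_coe_real_ereal.comp hk
  measurable_l := by
    classical
    exact Measurable.ite isClosed_closure.measurableSet (measurable_conjDown k) measurable_const
  k_ne_bot v := EReal.coe_ne_bot _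
  l_ne_bot := extDown_ne_bot k
  k_finite := ⟨0, EReal.coe_ne_top _⟩
  l_finite := by
    obtain ⟨u, hu, h⟩ := hfin
    exact ⟨u, by rwa [extDown_of_mem hu]⟩
  l_top u hu := extDown_of_notMem hu
  ineq u v := by
    by_cases hu : u ∈ closure Λ
    · rw [extDown_of_mem hu]; exact inner_le_add_conjDown k u v
    · rw [extDown_of_notMem hu, EReal.coe_add_top]; exact le_top

end Conjugates

/-! ### The transport domains -/

/-- Two sets of equal finite positive volume, the second one with negligible boundary and contained
in a ball. -/
structure TransportDomains {d : ℕ} (Ω Λ : Set (Vec d)) (R : ℝ) : Prop where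
  measurableSet : MeasurableSet Ω
  volume_ne_top : volume Ω ≠ ⊤
  volume_ne_zero : volume Ω ≠ 0
  volume_eq : volume Ω = volume Λ
  restrict_closure : volume.restrict Λ = volume.restrict (closure Λ)
  norm_le : ∀ u ∈ closure Λ, ‖u‖ ≤ R
  nonneg : 0 ≤ R

/-! ### Integrability of the dual terms and reduction to normalized conjugate pairs -/

section Reduction

variable {d : ℕ} {Ω Λ : Set (Vec d)} {q R : ℝ} {F : Vec d → Vec d} {f : Mat d → ℝ}

namespace TransportDomains

lemma isFiniteMeasure_left (h : TransportDomains Ω Λ R) :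
    IsFiniteMeasure (volume.restrict Ω) :=
  ⟨by rw [Measure.restrict_apply_univ]; exact h.volume_ne_top.lt_top⟩

lemma isFiniteMeasure_right (h : TransportDomains Ω Λ R) :
    IsFiniteMeasure (volume.restrict Λ) :=
  ⟨by rw [Measure.restrict_apply_univ, ← h.volume_eq]; exact h.volume_ne_top.lt_top⟩

lemma ae_mem_closure (h : TransportDomains Ω Λ R) : ∀ᵐ u ∂volume.restrict Λ, u ∈ closure Λ := by
  rw [h.restrict_closure]
  exact ae_restrict_mem isClosed_closure.measurableSet

lemma integral_const_eq (h : TransportDomains Ω Λ R) (c : ℝ) :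
    ∫ _ in Λ, c = ∫ _ in Ω, c := by
  simp [Measure.real, h.volume_eq]

lemma neZero (h : TransportDomains Ω Λ R) : NeZero (volume.restrict Λ) :=
  ⟨by
    rw [Ne, Measure.restrict_eq_zero, ← h.volume_eq]
    exact h.volume_ne_zero⟩

end TransportDomains

lemma hasIntegrableMinorant_of_const {X : Type*} [MeasurableSpace X] {μ : Measure X}
    [IsFiniteMeasure μ] {g : X → EReal} (c : ℝ) (hg : ∀ᵐ x ∂μ, (c : EReal) ≤ g x) :
    HasIntegrableMinorant μ g :=
  ⟨fun _ => c, integrable_const c, hg⟩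

lemma hasIntegrableMinorant_legendre {X : Type*} [MeasurableSpace X] {μ : Measure X}
    [IsFiniteMeasure μ] {E : Type*} [NormedAddCommGroup E] [InnerProductSpace ℝ E]
    (f : E → ℝ) (φ : X → E) : HasIntegrableMinorant μ (fun x => legendre f (φ x)) :=
  hasIntegrableMinorant_of_const (-f 0)
    (Eventually.of_forall fun x => neg_apply_zero_le_legendre f (φ x))

lemma LipschitzWith.integrable_comp {X E : Type*} [MeasurableSpace X] [NormedAddCommGroup E]
    {μ : Measure X} [IsFiniteMeasure μ] {K : NNReal} {k : E → ℝ} (hk : LipschitzWith K k)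
    {G : X → E} (hG : Integrable G μ) : Integrable (fun x => k (G x)) μ := by
  refine Integrable.mono' (g := fun x => K * ‖G x‖ + |k 0|)
    ((hG.norm.const_mul _).add (integrable_const _))
    (hk.continuous.comp_aestronglyMeasurable hG.1) (Eventually.of_forall fun x => ?_)
  have := hk.dist_le_mul (G x) 0
  rw [Real.dist_eq, dist_zero_right] at this
  rw [Real.norm_eq_abs]
  have h2 := abs_sub_abs_le_abs_sub (k (G x)) (k 0)
  linarith

lemma Admissible.hasIntegrableMinorant_right {k l : Vec d → EReal} (h : Admissible Λ k l)
    (hD : TransportDomains Ω Λ R) : HasIntegrableMinorant (volume.restrict Λ) l := by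
  have := hD.isFiniteMeasure_right
  obtain ⟨v, hv⟩ := h.k_finite
  refine hasIntegrableMinorant_of_const (-(R * ‖v‖) - (k v).toReal) ?_
  filter_upwards [hD.ae_mem_closure] with u hu
  have h1 := h.ineq u v
  have h2 : -(R * ‖v‖) ≤ ⟪u, v⟫ := by
    have := (abs_real_inner_le_norm u v).trans
      (mul_le_mul_of_nonneg_right (hD.norm_le u hu) (norm_nonneg v))
    linarith [neg_abs_le ⟪u, v⟫]
  rw [← EReal.coe_toReal hv (h.k_ne_bot v), add_comm] at h1
  rw [EReal.coe_sub]
  exact (EReal.sub_le_iff_le_add (Or.inl (EReal.coe_ne_bot _)) (Or.inl (EReal.coe_ne_top _))).2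
    ((EReal.coe_le_coe_iff.2 h2).trans h1)

/-- Freezing u at a point where l is finite leaves an affine minorant of k, which is integrable
along G. -/
lemma Admissible.hasIntegrableMinorant_left {k l : Vec d → EReal} (h : Admissible Λ k l)
    (hD : TransportDomains Ω Λ R) {G : Vec d → Vec d} (hG : Integrable G (volume.restrict Ω)) :
    HasIntegrableMinorant (volume.restrict Ω) (fun x => k (G x)) := by
  have := hD.isFiniteMeasure_left
  obtain ⟨u, hu⟩ := h.l_finite
  refine ⟨fun x => ⟪u, G x⟫ - (l u).toReal, (hG.const_inner u).sub (integrable_const _),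
    Eventually.of_forall fun x => ?_⟩
  have h1 := h.ineq u (G x)
  rw [← EReal.coe_toReal hu (h.l_ne_bot u)] at h1
  rw [EReal.coe_sub]
  exact (EReal.sub_le_iff_le_add (Or.inl (EReal.coe_ne_bot _)) (Or.inl (EReal.coe_ne_top _))).2 h1

lemma aemeasurable_legendre_fst (φ : SobolevPair d Ω q) :
    AEMeasurable (fun x => legendre f (φ.1 x)) (volume.restrict Ω) :=
  (measurable_legendre f).comp_aemeasurable (Lp.aestronglyMeasurable φ.1).aemeasurable

lemma conjDown_nonneg {κ : Vec d → ℝ} (h0 : κ 0 = 0) (u : Vec d) :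
    0 ≤ conjDown (fun v => (κ v : EReal)) u := by
  have := le_conjDown κ u 0
  rwa [h0, inner_zero_right, sub_zero, EReal.coe_zero] at this

/-- Every admissible triple can be replaced by a conjugate pair with a normalized Lipschitz first
potential, without increasing the dual functional. -/
lemma Admissible.exists_isConjUp_J_le {k l : Vec d → EReal} (h : Admissible Λ k l)
    (hD : TransportDomains Ω Λ R) (φ : SobolevPair d Ω q)
    (hG : Integrable (fun x => F x + wdiv φ x) (volume.restrict Ω)) :
    ∃ κ : Vec d → ℝ, LipschitzWith R.toNNReal κ ∧ κ 0 = 0 ∧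
      IsConjUp Λ (conjDown fun v => (κ v : EReal)) κ ∧
      J Λ f F (fun v => (κ v : EReal)) (conjDown fun v => (κ v : EReal)) φ ≤ J Λ f F k l φ := by
  have := hD.isFiniteMeasure_left
  have := hD.isFiniteMeasure_right
  obtain ⟨κ, hκ⟩ := h.exists_isConjUp hD.norm_le
  -- Moving the constant κ(0) from the first potential to the second leaves J unchanged because Ω
  -- and Λ have equal volume.
  have hs := hκ.shift (κ 0)
  have hl' : ∀ u, l u + (κ 0 : EReal) ≠ ⊥ := fun u hb => by
    rcases EReal.add_eq_bot_iff.1 hb with hb | hb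
    · exact h.l_ne_bot u hb
    · exact EReal.coe_ne_bot _ hb
  have hlip := hκ.lipschitzWith h.l_ne_bot hD.nonneg hD.norm_le
  refine ⟨fun v => κ v - κ 0, hs.lipschitzWith hl' hD.nonneg hD.norm_le, sub_self _,
    hs.isConjUp_conjDown hl', ?_⟩
  unfold J
  refine add_le_add_left ?_ _
  have h1 : eint (volume.restrict Ω) (fun x => ((κ (F x + wdiv φ x) - κ 0 : ℝ) : EReal))
      ≤ eint (volume.restrict Ω) (fun x => k (F x + wdiv φ x))
        + ((-∫ _ in Ω, κ 0 : ℝ) : EReal) := by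
    have hi : Integrable (fun x => κ (F x + wdiv φ x) - κ 0) (volume.restrict Ω) :=
      (hlip.integrable_comp hG).sub (integrable_const _)
    rw [eint_coe hi, integral_sub (hlip.integrable_comp hG) (integrable_const _), sub_eq_add_neg, EReal.coe_add,
      ← eint_coe (hlip.integrable_comp hG)]
    exact add_le_add_left
      (eint_mono (Eventually.of_forall fun x => hκ.le_of_admissible h _)) _
  have h2 : eint (volume.restrict Λ) (conjDown fun v => ((κ v - κ 0 : ℝ) : EReal))
      ≤ eint (volume.restrict Λ) l + ((∫ _ in Ω, κ 0 : ℝ) : EReal) := by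
    rw [← hD.integral_const_eq, ← (h.hasIntegrableMinorant_right hD).eint_add_coe
      h.measurable_l.aemeasurable (integrable_const _)]
    refine eint_mono ?_
    filter_upwards [hD.ae_mem_closure] with u hu
    exact hs.conjDown_le hl' hu
  refine (add_le_add h1 h2).trans (le_of_eq ?_)
  rw [add_add_add_comm, ← EReal.coe_add, neg_add_cancel, EReal.coe_zero, add_zero]

end Reduction

/-! ### Existence of a dual optimizer -/

/-- A pointwise Arzelà–Ascoli argument. The values on a dense sequence lie in a compact product of
intervals, and the common Lipschitz constant turns convergence there into the Cauchy property
everywhere. Pointwise limits are enough for the integrals below. -/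
lemma exists_subseq_tendsto_of_lipschitzWith {E : Type*} [NormedAddCommGroup E]
    [TopologicalSpace.SeparableSpace E] {K : NNReal} {κ : ℕ → E → ℝ}
    (hκ : ∀ n, LipschitzWith K (κ n)) (h0 : ∀ n, κ n 0 = 0) :
    ∃ (k : E → ℝ) (ns : ℕ → ℕ), StrictMono ns ∧ LipschitzWith K k ∧ k 0 = 0 ∧
      ∀ v, Tendsto (fun n => κ (ns n) v) atTop (𝓝 (k v)) := by
  set x := TopologicalSpace.denseSeq E
  have hx : DenseRange x := TopologicalSpace.denseRange_denseSeq E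
  have hcomp : IsCompact (Set.pi univ fun i => Icc (-(K * ‖x i‖)) (K * ‖x i‖)) :=
    isCompact_univ_pi fun i => isCompact_Icc
  have hmem : ∀ n, (fun i => κ n (x i)) ∈
      (Set.pi univ fun i => Icc (-(K * ‖x i‖)) (K * ‖x i‖) : Set (ℕ → ℝ)) := by
    intro n i _
    have := (hκ n).dist_le_mul (x i) 0
    rw [h0, dist_zero_right, dist_zero_right, Real.norm_eq_abs] at this
    exact abs_le.1 this
  obtain ⟨a, -, ns, hns, ha⟩ := hcomp.tendsto_subseq hmem
  rw [tendsto_pi_nhds] at ha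
  have hlim : ∀ v, ∃ y, Tendsto (fun n => κ (ns n) v) atTop (𝓝 y) := by
    intro v
    refine cauchySeq_tendsto_of_complete (Metric.cauchySeq_iff.2 fun ε hε => ?_)
    obtain ⟨i, hi⟩ : ∃ i, dist v (x i) < ε / (3 * (K + 1)) :=
      hx.exists_dist_lt v (by positivity)
    have hi' : K * dist v (x i) < ε / 3 := by
      have h1 : (K : ℝ) * dist v (x i) ≤ (K + 1) * dist v (x i) :=
        mul_le_mul_of_nonneg_right (by linarith) dist_nonneg
      have h2 : ((K : ℝ) + 1) * dist v (x i) < (K + 1) * (ε / (3 * (K + 1))) :=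
        mul_lt_mul_of_pos_left hi (by positivity)
      have h3 : ((K : ℝ) + 1) * (ε / (3 * (K + 1))) = ε / 3 := by field_simp
      linarith
    obtain ⟨N, hN⟩ := Metric.cauchySeq_iff.1 (ha i).cauchySeq (ε / 3) (by positivity)
    refine ⟨N, fun m hm n hn => ?_⟩
    have h1 := (hκ (ns m)).dist_le_mul v (x i)
    have h2 := (hκ (ns n)).dist_le_mul v (x i)
    have h3 := hN m hm n hn
    have h4 := dist_triangle4 (κ (ns m) v) (κ (ns m) (x i)) (κ (ns n) (x i)) (κ (ns n) v)
    rw [dist_comm (κ (ns n) (x i))] at h4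
    simp only [Function.comp] at h3
    linarith
  choose k hk using hlim
  refine ⟨k, ns, hns, LipschitzWith.of_dist_le_mul fun v w => ?_, ?_, hk⟩
  · exact le_of_tendsto ((hk v).dist (hk w))
      (Eventually.of_forall fun n => (hκ (ns n)).dist_le_mul v w)
  · have := hk 0
    simp only [h0] at this
    exact tendsto_nhds_unique this tendsto_const_nhds

section Existence

variable {d : ℕ} {Ω Λ : Set (Vec d)} {q R : ℝ} {F : Vec d → Vec d} {f : Mat d → ℝ}
  [Fact (1 ≤ ENNReal.ofReal q)] {S : Set (SobolevPair d Ω q)}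

/-- Each affine term of the supremum converges, and it is dominated by the conjugate along the
sequence. -/
lemma conjDown_le_liminf {κ : ℕ → Vec d → ℝ} {k : Vec d → ℝ}
    (h : ∀ v, Tendsto (fun n => κ n v) atTop (𝓝 (k v))) (u : Vec d) :
    conjDown (fun v => (k v : EReal)) u
      ≤ liminf (fun n => conjDown (fun v => (κ n v : EReal)) u) atTop := by
  rw [conjDown_le_iff]
  intro v
  have ht : Tendsto (fun n => ((⟪u, v⟫ - κ n v : ℝ) : EReal)) atTop
      (𝓝 ((⟪u, v⟫ - k v : ℝ) : EReal)) :=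
    (continuous_coe_real_ereal.tendsto _).comp (tendsto_const_nhds.sub (h v))
  rw [← ht.liminf_eq]
  exact liminf_le_liminf (Eventually.of_forall fun n => le_conjDown (κ n) u v)

lemma legendre_le_liminf {E : Type*} [NormedAddCommGroup E] [InnerProductSpace ℝ E]
    (f : E → ℝ) {y : ℕ → E} {z : E} (h : Tendsto y atTop (𝓝 z)) :
    legendre f z ≤ liminf (fun n => legendre f (y n)) atTop := by
  refine iSup_le fun x => ?_
  have ht : Tendsto (fun n => ((⟪x, y n⟫ - f x : ℝ) : EReal)) atTop
      (𝓝 ((⟪x, z⟫ - f x : ℝ) : EReal)) :=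
    (continuous_coe_real_ereal.tendsto _).comp ((tendsto_const_nhds.inner h).sub_const _)
  rw [← ht.liminf_eq]
  exact liminf_le_liminf (Eventually.of_forall fun n => le_legendre f x (y n))

/-- The ambient Sobolev space need not be proper, but the finite-dimensional span of S is. -/
lemma isCompact_inter_closedBall (hScl : IsClosed S)
    [FiniteDimensional ℝ (Submodule.span ℝ S)] (B : ℝ) :
    IsCompact (S ∩ Metric.closedBall 0 B) := by
  have := FiniteDimensional.proper ℝ (Submodule.span ℝ S)
  have h1 : IsCompact (((↑) : Submodule.span ℝ S → SobolevPair d Ω q) ⁻¹'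
      (S ∩ Metric.closedBall 0 B)) := by
    refine Metric.isCompact_of_isClosed_isBounded
      ((hScl.inter Metric.isClosed_closedBall).preimage continuous_subtype_val) ?_
    refine (Metric.isBounded_closedBall (x := 0) (r := B)).subset fun P hP => ?_
    simpa using hP.2
  have h2 := h1.image continuous_subtype_val
  rwa [image_preimage_eq_of_subset] at h2
  exact fun P hP => ⟨⟨P, Submodule.subset_span hP.1⟩, rfl⟩

lemma integrable_field (hD : TransportDomains Ω Λ R) (hF : Integrable F (volume.restrict Ω))
    (φ : SobolevPair d Ω q) : Integrable (fun x => F x + wdiv φ x) (volume.restrict Ω) :=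
  have := hD.isFiniteMeasure_left
  hF.add (integrable_wdiv φ)

/-- Coercivity of the dual functional on normalized Lipschitz potentials. -/
lemma exists_norm_sub_le_J (hD : TransportDomains Ω Λ R) (hF : Integrable F (volume.restrict Ω))
    (hS : S ⊆ W0 d Ω q) [FiniteDimensional ℝ (Submodule.span ℝ S)]
    (hf : ∀ K : ℝ, ∃ C : ℝ, ∀ y, ((K * ‖y‖ - C : ℝ) : EReal) ≤ legendre f y) :
    ∃ C : ℝ, ∀ κ : Vec d → ℝ, LipschitzWith R.toNNReal κ → κ 0 = 0 → ∀ φ ∈ S,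
      ((‖φ‖ - C : ℝ) : EReal)
        ≤ J Λ f F (fun v => (κ v : EReal)) (conjDown fun v => (κ v : EReal)) φ := by
  have := hD.isFiniteMeasure_left
  obtain ⟨C₀, hC₀, hnorm⟩ := exists_norm_le_integral_norm_fst hS
  set M := ‖divL1 (Ω := Ω) (q := q)‖ with hM
  -- The potential term can be as negative as -R·M·‖φ‖. After the factor C₀ is spent on comparing
  -- norms, this slope compensates that and leaves one ‖φ‖ over.
  obtain ⟨C₁, hC₁⟩ := hf (C₀ * (R * M + 1))
  refine ⟨R * (∫ x in Ω, ‖F x‖) + ∫ _ in Ω, C₁, fun κ hκ h0 φ hφ => ?_⟩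
  have hG := integrable_field hD hF φ
  have hR := hD.nonneg
  have h1 : ((-(R * (∫ x in Ω, ‖F x‖) + R * (M * ‖φ‖)) : ℝ) : EReal)
      ≤ eint (volume.restrict Ω) (fun x => (κ (F x + wdiv φ x) : EReal)) := by
    rw [eint_coe (hκ.integrable_comp hG), EReal.coe_le_coe_iff]
    have hb : ∀ v, |κ v| ≤ R * ‖v‖ := fun v => by
      have := hκ.dist_le_mul v 0
      rwa [h0, dist_zero_right, dist_zero_right, Real.norm_eq_abs, Real.coe_toNNReal R hR] at this
    have h2 : |∫ x in Ω, κ (F x + wdiv φ x)| ≤ ∫ x in Ω, R * (‖F x‖ + ‖wdiv φ x‖) := by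
      have hi : Integrable (fun x => R * (‖F x‖ + ‖wdiv φ x‖)) (volume.restrict Ω) :=
        (hF.norm.add (integrable_wdiv φ).norm).const_mul R
      refine norm_integral_le_of_norm_le hi (Eventually.of_forall fun x =>
        (Real.norm_eq_abs _).le.trans ((hb _).trans ?_))
      exact mul_le_mul_of_nonneg_left (norm_add_le _ _) hR
    rw [integral_const_mul, integral_add hF.norm (integrable_wdiv φ).norm, integral_norm_wdiv,
      mul_add] at h2
    have h3 := mul_le_mul_of_nonneg_left ((divL1 (Ω := Ω) (q := q)).le_opNorm φ) hR
    have := neg_abs_le (∫ x in Ω, κ (F x + wdiv φ x))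
    linarith
  have h2 : 0 ≤ eint (volume.restrict Λ) (conjDown fun v => (κ v : EReal)) := by
    rw [eint_of_nonneg (Eventually.of_forall fun u => conjDown_nonneg h0 u)]
    exact EReal.coe_ennreal_nonneg _
  have h3 : (((R * M + 1) * ‖φ‖ - ∫ _ in Ω, C₁ : ℝ) : EReal)
      ≤ eint (volume.restrict Ω) (fun x => legendre f (φ.1 x)) := by
    refine le_trans ?_ (eint_mono (Eventually.of_forall fun x => hC₁ (φ.1 x)))
    have hi := (integrable_fst φ).norm.const_mul (C₀ * (R * M + 1))
    have hi' : Integrable (fun x => C₀ * (R * M + 1) * ‖φ.1 x‖ - C₁) (volume.restrict Ω) :=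
      hi.sub (integrable_const _)
    rw [eint_coe hi', integral_sub hi (integrable_const _),
      integral_const_mul, EReal.coe_le_coe_iff]
    have := hnorm φ (Submodule.subset_span hφ)
    have hpos : 0 ≤ R * M + 1 := by positivity
    have := mul_le_mul_of_nonneg_left this hpos
    nlinarith
  have h4 := add_le_add (add_le_add h1 h2) h3
  rw [add_zero, ← EReal.coe_add] at h4
  refine le_trans (EReal.coe_le_coe_iff.2 (le_of_eq ?_)) h4
  ring

/-- The dual functional is lower semicontinuous along converging sequences of potentials. -/
lemma J_le_liminf (hD : TransportDomains Ω Λ R) (hF : Integrable F (volume.restrict Ω))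
    {κ : ℕ → Vec d → ℝ} {k : Vec d → ℝ} {φ : ℕ → SobolevPair d Ω q} {ψ : SobolevPair d Ω q}
    (hκ : ∀ n, LipschitzWith R.toNNReal (κ n)) (h0 : ∀ n, κ n 0 = 0)
    (hk : LipschitzWith R.toNNReal k) (hk0 : k 0 = 0)
    (hlim : ∀ v, Tendsto (fun n => κ n v) atTop (𝓝 (k v))) (hφ : Tendsto φ atTop (𝓝 ψ))
    (hae : ∀ᵐ x ∂volume.restrict Ω, Tendsto (fun n => (φ n).1 x) atTop (𝓝 (ψ.1 x))) :
    J Λ f F (fun v => (k v : EReal)) (conjDown fun v => (k v : EReal)) ψ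
      ≤ liminf (fun n => J Λ f F (fun v => (κ n v : EReal))
          (conjDown fun v => (κ n v : EReal)) (φ n)) atTop := by
  have := hD.isFiniteMeasure_left
  have := hD.isFiniteMeasure_right
  have hA : Tendsto (fun n => ∫ x in Ω, κ n (F x + wdiv (φ n) x)) atTop
      (𝓝 (∫ x in Ω, k (F x + wdiv ψ x))) := by
    -- The potential and the field are varied one at a time: dominated convergence at the limiting
    -- field, then the uniform Lipschitz bound for the change of field in L^1.
    have h1 : Tendsto (fun n => ∫ x in Ω, κ n (F x + wdiv ψ x)) atTop
        (𝓝 (∫ x in Ω, k (F x + wdiv ψ x))) := by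
      refine tendsto_integral_of_dominated_convergence
        (fun x => R.toNNReal * ‖F x + wdiv ψ x‖)
        (fun n => ((hκ n).integrable_comp (integrable_field hD hF ψ)).1)
        ((integrable_field hD hF ψ).norm.const_mul _) (fun n => Eventually.of_forall fun x => ?_)
        (Eventually.of_forall fun x => hlim _)
      have := (hκ n).dist_le_mul (F x + wdiv ψ x) 0
      rwa [h0, dist_zero_right, dist_zero_right] at this
    have h2 : Tendsto (fun n => ∫ x in Ω, (κ n (F x + wdiv (φ n) x) - κ n (F x + wdiv ψ x))) atTop
        (𝓝 0) := by
      have hz : Tendsto (fun n => R.toNNReal * ‖divL1 (φ n - ψ)‖) atTop (𝓝 0) := by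
        have hc : Tendsto (fun n => R.toNNReal * ‖divL1 (φ n - ψ)‖) atTop
            (𝓝 (R.toNNReal * ‖divL1 (ψ - ψ)‖)) :=
          (((divL1.continuous.tendsto _).comp (hφ.sub_const ψ)).norm).const_mul _
        simpa using hc
      refine squeeze_zero_norm (fun n => ?_) hz
      rw [← integral_norm_wdiv, ← integral_const_mul]
      refine norm_integral_le_of_norm_le ((integrable_wdiv _).norm.const_mul _) ?_
      filter_upwards [Lp.coeFn_sub (φ n).2 ψ.2] with x hx
      have := (hκ n).dist_le_mul (F x + wdiv (φ n) x) (F x + wdiv ψ x)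
      rw [Real.dist_eq, dist_eq_norm, add_sub_add_left_eq_sub] at this
      have he : wdiv (φ n - ψ) x = wdiv (φ n) x - wdiv ψ x := by
        simp only [wdiv_eq_rowTrace, Prod.snd_sub, hx, Pi.sub_apply, map_sub]
      rw [he]
      exact this
    have h3 := h2.add h1
    rw [zero_add] at h3
    refine h3.congr fun n => ?_
    rw [← integral_add]
    · simp
    · exact ((hκ n).integrable_comp (integrable_field hD hF _)).sub
        ((hκ n).integrable_comp (integrable_field hD hF ψ))
    · exact (hκ n).integrable_comp (integrable_field hD hF ψ)
  have hA' : eint (volume.restrict Ω) (fun x => (k (F x + wdiv ψ x) : EReal))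
      ≤ liminf (fun n => eint (volume.restrict Ω)
          (fun x => (κ n (F x + wdiv (φ n) x) : EReal))) atTop := by
    rw [eint_coe (hk.integrable_comp (integrable_field hD hF ψ))]
    simp only [fun n => eint_coe ((hκ n).integrable_comp (integrable_field hD hF (φ n)))]
    exact (((continuous_coe_real_ereal.tendsto _).comp hA).liminf_eq).ge
  have hB : eint (volume.restrict Λ) (conjDown fun v => (k v : EReal))
      ≤ liminf (fun n => eint (volume.restrict Λ) (conjDown fun v => (κ n v : EReal))) atTop :=
    eint_le_liminf_of_nonneg (fun n => (measurable_conjDown (κ n)).aemeasurable)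
      (Eventually.of_forall fun u => conjDown_nonneg hk0 u)
      (fun n => Eventually.of_forall fun u => conjDown_nonneg (h0 n) u)
      (Eventually.of_forall fun u => conjDown_le_liminf hlim u)
  have hC : eint (volume.restrict Ω) (fun x => legendre f (ψ.1 x))
      ≤ liminf (fun n => eint (volume.restrict Ω) (fun x => legendre f ((φ n).1 x))) atTop :=
    eint_le_liminf (-f 0) (aemeasurable_legendre_fst ψ)
      (fun n => aemeasurable_legendre_fst (φ n))
      (Eventually.of_forall fun x => neg_apply_zero_le_legendre f _)
      (fun n => Eventually.of_forall fun x => neg_apply_zero_le_legendre f _)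
      (hae.mono fun x hx => legendre_le_liminf f hx)
  refine (add_le_add (add_le_add hA' hB) hC).trans ?_
  refine (add_le_add_left EReal.le_liminf_add _).trans ?_
  exact EReal.le_liminf_add

/-- The potential R‖v‖ works: it has linear growth, and by Cauchy–Schwarz its conjugate is at most 0
on the closure of Λ. -/
lemma exists_J_ne_top (hD : TransportDomains Ω Λ R) (hF : Integrable F (volume.restrict Ω))
    {φ : SobolevPair d Ω q} (hφ : eint (volume.restrict Ω) (fun x => legendre f (φ.1 x)) ≠ ⊤) :
    ∃ κ : Vec d → ℝ, LipschitzWith R.toNNReal κ ∧ κ 0 = 0 ∧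
      J Λ f F (fun v => (κ v : EReal)) (conjDown fun v => (κ v : EReal)) φ ≠ ⊤ := by
  have := hD.isFiniteMeasure_left
  have hlip : LipschitzWith R.toNNReal fun v : Vec d => R * ‖v‖ :=
    LipschitzWith.of_le_add_mul' _ fun v w => by
      rw [dist_eq_norm, ← mul_add]
      refine mul_le_mul_of_nonneg_left ?_ hD.nonneg
      simpa using norm_add_le w (v - w)
  refine ⟨fun v => R * ‖v‖, hlip, by simp, ?_⟩
  have hB : eint (volume.restrict Λ) (conjDown fun v : Vec d => ((R * ‖v‖ : ℝ) : EReal)) ≤ 0 := by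
    have h0 : eint (volume.restrict Λ) (fun _ => ((0 : ℝ) : EReal)) = 0 := by
      rw [eint_coe (g := fun _ => (0 : ℝ)) (integrable_zero _ _ _), integral_zero, EReal.coe_zero]
    rw [← h0]
    refine eint_mono ?_
    filter_upwards [hD.ae_mem_closure] with u hu
    rw [conjDown_le_iff]
    intro v
    rw [EReal.coe_le_coe_iff]
    have := (real_inner_le_norm u v).trans
      (mul_le_mul_of_nonneg_right (hD.norm_le u hu) (norm_nonneg v))
    linarith
  unfold J
  rw [eint_coe (hlip.integrable_comp (integrable_field hD hF φ))]
  refine (EReal.add_lt_top ?_ hφ).ne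
  exact (EReal.add_lt_top (EReal.coe_ne_top _) (hB.trans_lt EReal.zero_lt_top).ne).ne

/-- The direct method: coercivity confines a minimizing sequence to a compact part of S, and the
potentials converge pointwise along a further subsequence. -/
lemma exists_minimizer (hD : TransportDomains Ω Λ R) (hF : Integrable F (volume.restrict Ω))
    (hS : S ⊆ W0 d Ω q) (hScl : IsClosed S) [FiniteDimensional ℝ (Submodule.span ℝ S)]
    (hf : ∀ K : ℝ, ∃ C : ℝ, ∀ y, ((K * ‖y‖ - C : ℝ) : EReal) ≤ legendre f y)
    (hfin : (finitePart f S).Nonempty) :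
    ∃ κ : Vec d → ℝ, ∃ φ ∈ S, LipschitzWith R.toNNReal κ ∧ κ 0 = 0 ∧
      J Λ f F (fun v => (κ v : EReal)) (conjDown fun v => (κ v : EReal)) φ ≠ ⊤ ∧
      ∀ κ' : Vec d → ℝ, LipschitzWith R.toNNReal κ' → κ' 0 = 0 → ∀ φ' ∈ S,
        J Λ f F (fun v => (κ v : EReal)) (conjDown fun v => (κ v : EReal)) φ
          ≤ J Λ f F (fun v => (κ' v : EReal)) (conjDown fun v => (κ' v : EReal)) φ' := by
  have := hD.isFiniteMeasure_left
  set E : (Vec d → ℝ) → SobolevPair d Ω q → EReal := fun κ φ =>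
    J Λ f F (fun v => (κ v : EReal)) (conjDown fun v => (κ v : EReal)) φ with hE
  set A : Set EReal := {j | ∃ κ : Vec d → ℝ, ∃ φ ∈ S, LipschitzWith R.toNNReal κ ∧ κ 0 = 0 ∧
    j = E κ φ} with hA
  obtain ⟨φ₁, hφ₁S, hφ₁, -⟩ := hfin
  obtain ⟨κ₁, hκ₁, hκ₁0, hκ₁t⟩ := exists_J_ne_top hD hF hφ₁
  have hne : A.Nonempty := ⟨_, κ₁, φ₁, hφ₁S, hκ₁, hκ₁0, rfl⟩
  have hmtop : sInf A < ⊤ :=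
    lt_of_le_of_lt (sInf_le ⟨κ₁, φ₁, hφ₁S, hκ₁, hκ₁0, rfl⟩) hκ₁t.lt_top
  obtain ⟨s, -, hs, hsA⟩ := exists_seq_tendsto_sInf hne (OrderBot.bddBelow A)
  choose κ φ hφS hκ hκ0 hsE using hsA
  obtain ⟨C, hC⟩ := exists_norm_sub_le_J (f := f) hD hF hS hf
  obtain ⟨B, hB1, -⟩ := EReal.lt_iff_exists_real_btwn.1 hmtop
  have hbdd : ∀ᶠ n in atTop, φ n ∈ S ∩ Metric.closedBall 0 (B + C) := by
    filter_upwards [hs.eventually (gt_mem_nhds hB1)] with n hn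
    refine ⟨hφS n, ?_⟩
    have h1 := (hC (κ n) (hκ n) (hκ0 n) (φ n) (hφS n)).trans ((hsE n).ge.trans hn.le)
    rw [EReal.coe_le_coe_iff] at h1
    rw [mem_closedBall_zero_iff]
    linarith
  obtain ⟨ψ, hψ, n₁, hn₁, hlim₁⟩ :=
    (isCompact_inter_closedBall hScl (B + C)).tendsto_subseq' hbdd.frequently
  obtain ⟨k, n₂, hn₂, hk, hk0, hlim₂⟩ := exists_subseq_tendsto_of_lipschitzWith
    (κ := fun n => κ (n₁ n)) (fun n => hκ _) (fun n => hκ0 _)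
  have hlim₃ : Tendsto (fun n => fstL1 (φ (n₁ (n₂ n)))) atTop (𝓝 (fstL1 ψ)) :=
    (fstL1.continuous.tendsto ψ).comp (hlim₁.comp hn₂.tendsto_atTop)
  -- A third extraction turns convergence of φ in L^1 into almost everywhere convergence, as Fatou's
  -- lemma for f*(φ) requires.
  obtain ⟨n₃, hn₃, hlim₄⟩ := (tendstoInMeasure_of_tendsto_Lp hlim₃).exists_seq_tendsto_ae
  have hkey := J_le_liminf (f := f) (Λ := Λ) hD hF (κ := fun n => κ (n₁ (n₂ (n₃ n))))
    (φ := fun n => φ (n₁ (n₂ (n₃ n)))) (fun n => hκ _) (fun n => hκ0 _) hk hk0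
    (fun v => (hlim₂ v).comp hn₃.tendsto_atTop)
    (hlim₁.comp (hn₂.tendsto_atTop.comp hn₃.tendsto_atTop)) hlim₄
  have hs' : Tendsto (fun n => s (n₁ (n₂ (n₃ n)))) atTop (𝓝 (sInf A)) :=
    hs.comp (hn₁.tendsto_atTop.comp (hn₂.tendsto_atTop.comp hn₃.tendsto_atTop))
  have hmin : E k ψ ≤ sInf A := by
    rw [← hs'.liminf_eq]
    simp only [hsE]
    exact hkey
  exact ⟨k, ψ, hψ.1, hk, hk0, (hmin.trans_lt hmtop).ne, fun κ' h1 h2 φ' hφ' =>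
    hmin.trans (sInf_le ⟨κ', φ', hφ', h1, h2, rfl⟩)⟩

end Existence

/-! ### Differentiability points of a conjugate potential -/

section Gradient

variable {d : ℕ} {Λ : Set (Vec d)} {l : Vec d → EReal} {κ : Vec d → ℝ} {v g : Vec d}

namespace IsConjUp

/-- At a differentiability point of `l^&`, near-maximizers are close to the gradient. -/
lemma exists_norm_sub_le (h : IsConjUp Λ l κ) (hl : ∀ u, l u ≠ ⊥) (hg : HasGradientAt κ g v)
    {η : ℝ} (hη : 0 < η) :
    ∃ δ : ℝ, 0 < δ ∧ ∀ u ∈ closure Λ,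
      ((κ v - δ : ℝ) : EReal) + l u ≤ ((⟪u, v⟫ : ℝ) : EReal) → ‖u - g‖ ≤ η := by
  have hη2 : 0 < η / 2 := by positivity
  have hd := (hasGradientAt_iff_isLittleO.1 hg).def hη2
  obtain ⟨s, hs, hball⟩ := Metric.eventually_nhds_iff_ball.1 hd
  -- Testing at v + w with w of length s/2 along u - g gives (s/2)‖u - g‖ ≤ δ + (η/2)(s/2), where
  -- the last term is the differentiability error. This δ makes the right side (s/2)η.
  refine ⟨η / 2 * (s / 2), by positivity, fun u hu hmax => ?_⟩
  rcases eq_or_ne u g with rfl | hne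
  · simpa using hη.le
  have hlt : l u ≠ ⊤ := fun ht => by
    rw [ht, EReal.coe_add_top] at hmax
    exact EReal.coe_ne_top _ (top_le_iff.1 hmax)
  have hpos : 0 < ‖u - g‖ := norm_pos_iff.2 (sub_ne_zero.2 hne)
  set w : Vec d := (s / 2 / ‖u - g‖) • (u - g) with hw
  have hwn : ‖w‖ = s / 2 := by
    rw [hw, norm_smul, Real.norm_of_nonneg (by positivity)]
    field_simp
  have h1 := h.inner_le hl hu (v + w)
  rw [← EReal.coe_toReal hlt (hl u), ← EReal.coe_add, EReal.coe_le_coe_iff] at h1 hmax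
  have h2 := hball (v + w) (by rw [mem_ball_iff_norm, add_sub_cancel_left, hwn]; linarith)
  rw [add_sub_cancel_left, hwn, Real.norm_eq_abs] at h2
  have h3 := (abs_le.1 h2).2
  have h4 : ⟪u, v + w⟫ = ⟪u, v⟫ + ⟪u, w⟫ := inner_add_right _ _ _
  have h5 : ⟪u, w⟫ - ⟪g, w⟫ = s / 2 * ‖u - g‖ := by
    rw [← inner_sub_left, hw, inner_smul_right, real_inner_self_eq_norm_sq]
    field_simp
  have h6 : s / 2 * ‖u - g‖ ≤ s / 2 * η := by linarith
  exact le_of_mul_le_mul_left h6 (by positivity)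

lemma exists_near_max (h : IsConjUp Λ l κ) (hl : ∀ u, l u ≠ ⊥) (v : Vec d) {δ : ℝ} (hδ : 0 < δ) :
    ∃ u ∈ closure Λ, ((κ v - δ : ℝ) : EReal) + l u ≤ ((⟪u, v⟫ : ℝ) : EReal) := by
  by_contra! hcon
  have := h.le_of_forall hl (v := v) (c := κ v - δ) fun u hu => (hcon u hu).le
  linarith

/-- An exact maximizer is a near-maximizer for every tolerance. This is the source of primal
uniqueness. -/
lemma eq_of_le (h : IsConjUp Λ l κ) (hl : ∀ u, l u ≠ ⊥) (hg : HasGradientAt κ g v) {u : Vec d}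
    (hu : u ∈ closure Λ) (hmax : (κ v : EReal) + l u ≤ ((⟪u, v⟫ : ℝ) : EReal)) : u = g := by
  refine sub_eq_zero.1 (norm_le_zero_iff.1 (le_of_forall_pos_le_add fun η hη => ?_))
  rw [zero_add]
  obtain ⟨δ, hδ, hδu⟩ := h.exists_norm_sub_le hl hg hη
  refine hδu u hu (le_trans (add_le_add_left ?_ _) hmax)
  rw [EReal.coe_le_coe_iff]
  linarith

lemma gradient_mem_closure (h : IsConjUp Λ l κ) (hl : ∀ u, l u ≠ ⊥) (hg : HasGradientAt κ g v) :
    g ∈ closure Λ := by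
  rw [← closure_closure, Metric.mem_closure_iff]
  intro ε hε
  obtain ⟨δ, hδ, hδu⟩ := h.exists_norm_sub_le hl hg (half_pos hε)
  obtain ⟨u, hu, hmax⟩ := h.exists_near_max hl v hδ
  refine ⟨u, hu, ?_⟩
  rw [dist_comm, dist_eq_norm]
  linarith [hδu u hu hmax]

/-- Near-maximizers u at v satisfy the subgradient inequality up to a small error, and they tend to
g. Lower semicontinuity of l is not needed for this. -/
lemma gradient_conjDown_le (h : IsConjUp Λ l κ) (hl : ∀ u, l u ≠ ⊥) (hg : HasGradientAt κ g v) :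
    conjDown (fun v => (κ v : EReal)) g ≤ ((⟪g, v⟫ - κ v : ℝ) : EReal) := by
  rw [conjDown_le_iff]
  intro w
  rw [EReal.coe_le_coe_iff]
  have key : ∀ η : ℝ, 0 < η → ⟪g, w - v⟫ ≤ κ w - κ v + η * (1 + ‖w - v‖) := by
    intro η hη
    obtain ⟨δ, hδ, hδu⟩ := h.exists_norm_sub_le hl hg hη
    obtain ⟨u, hu, hmax⟩ := h.exists_near_max hl v (lt_min hδ hη)
    have hlt : l u ≠ ⊤ := fun ht => by
      rw [ht, EReal.coe_add_top] at hmax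
      exact EReal.coe_ne_top _ (top_le_iff.1 hmax)
    have hnear := hδu u hu (le_trans (add_le_add_left (by
      rw [EReal.coe_le_coe_iff]; linarith [min_le_left δ η]) _) hmax)
    have h1 := h.inner_le hl hu w
    rw [← EReal.coe_toReal hlt (hl u), ← EReal.coe_add, EReal.coe_le_coe_iff] at h1 hmax
    have h2 : ⟪u - g, w - v⟫ ≥ -(η * ‖w - v‖) := by
      have := abs_real_inner_le_norm (u - g) (w - v)
      have h3 := mul_le_mul_of_nonneg_right hnear (norm_nonneg (w - v))
      linarith [neg_abs_le ⟪u - g, w - v⟫]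
    rw [inner_sub_left, inner_sub_right u] at h2
    linarith [min_le_right δ η]
  have h0 : ⟪g, w - v⟫ ≤ κ w - κ v := by
    refine le_of_forall_pos_le_add fun ε hε => ?_
    have := key (ε / (1 + ‖w - v‖)) (by positivity)
    rwa [div_mul_cancel₀ _ (by positivity)] at this
  rw [inner_sub_right] at h0
  linarith

variable {h : Vec d → ℝ} {M : ℝ}

/-- One half of the envelope theorem: the derivative of l ↦ l^&(v) in direction h is -h(g), because
only near-maximizers matter and they cluster at g, where h is almost h(g). -/
lemma perturb_le (hκ : IsConjUp Λ l κ) (hl : ∀ u, l u ≠ ⊥) (hg : HasGradientAt κ g v)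
    (hh : Continuous h) (hM : ∀ u, |h u| ≤ M) {η : ℝ} (hη : 0 < η) :
    ∃ t₀ : ℝ, 0 < t₀ ∧ ∀ t : ℝ, 0 < t → t < t₀ → ∀ κ' : Vec d → ℝ,
      IsConjUp Λ (fun u => l u + ((t * h u : ℝ) : EReal)) κ' →
        κ' v ≤ κ v - t * h g + t * η := by
  obtain ⟨ρ, hρ, hball⟩ := Metric.continuous_iff.1 hh g η hη
  obtain ⟨δ, hδ, hδu⟩ := hκ.exists_norm_sub_le hl hg (half_pos hρ)
  have hM0 : 0 ≤ M := (abs_nonneg _).trans (hM g)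
  -- A point that is not a δ-near-maximizer can regain at most 2Mt < δ through the perturbation; the
  -- 1 covers M = 0.
  refine ⟨δ / (2 * M + 1), by positivity, fun t ht htt κ' hκ' => ?_⟩
  have ht2 : t * (2 * M + 1) < δ := (lt_div_iff₀ (by positivity)).1 htt
  refine hκ'.le_of_forall (fun u hb => ?_) fun u hu => ?_
  · rcases EReal.add_eq_bot_iff.1 hb with hb | hb
    · exact hl u hb
    · exact EReal.coe_ne_bot _ hb
  rcases eq_or_ne (l u) ⊤ with htop | htop
  · rw [htop, EReal.top_add_coe, EReal.coe_add_top]; exact le_top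
  have h1 := hκ.inner_le hl hu v
  have h2 := hδu u hu
  rw [← EReal.coe_toReal htop (hl u)] at h1 h2 ⊢
  norm_cast at h1 h2 ⊢
  by_cases hc : κ v - δ + (l u).toReal ≤ ⟪u, v⟫
  · have h3 := hball u (by rw [dist_eq_norm]; linarith [h2 hc])
    rw [Real.dist_eq] at h3
    have h4 := (abs_lt.1 h3).1
    nlinarith
  · have h3 := neg_le_of_abs_le (hM u)
    have h4 := le_of_abs_le (hM g)
    nlinarith

end IsConjUp

lemma Admissible.of_isConjUp {k : Vec d → EReal} (h : Admissible Λ k l) (hκ : IsConjUp Λ l κ)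
    (hm : Measurable κ) : Admissible Λ (fun v => (κ v : EReal)) l where
  measurable_k := measurable_coe_real_ereal.comp hm
  measurable_l := h.measurable_l
  k_ne_bot v := EReal.coe_ne_bot _
  l_ne_bot := h.l_ne_bot
  k_finite := ⟨0, EReal.coe_ne_top _⟩
  l_finite := h.l_finite
  l_top := h.l_top
  ineq u v := by
    by_cases hu : u ∈ closure Λ
    · exact hκ.inner_le h.l_ne_bot hu v
    · rw [h.l_top u hu, EReal.coe_add_top]; exact le_top

lemma Admissible.perturb {k : Vec d → ℝ} (hA : Admissible Λ (fun v => (k v : EReal)) l)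
    {h : Vec d → ℝ} {M : ℝ} (hh : Continuous h) (hM : ∀ u, |h u| ≤ M) :
    Admissible Λ (fun v => ((k v + M : ℝ) : EReal)) (fun u => l u + (h u : EReal)) where
  measurable_k := by
    simp only [EReal.coe_add]
    exact hA.measurable_k.add measurable_const
  measurable_l := hA.measurable_l.add (measurable_coe_real_ereal.comp hh.measurable)
  k_ne_bot v := EReal.coe_ne_bot _
  l_ne_bot u hb := by
    rcases EReal.add_eq_bot_iff.1 hb with hb | hb
    · exact hA.l_ne_bot u hb
    · exact EReal.coe_ne_bot _ hb
  k_finite := ⟨0, EReal.coe_ne_top _⟩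
  l_finite := by
    obtain ⟨u, hu⟩ := hA.l_finite
    exact ⟨u, (EReal.add_lt_top hu (EReal.coe_ne_top _)).ne⟩
  l_top u hu := by rw [hA.l_top u hu, EReal.top_add_coe]
  ineq u v := by
    have h1 := hA.ineq u v
    rcases eq_or_ne (l u) ⊤ with htop | htop
    · rw [htop, EReal.top_add_coe, EReal.coe_add_top]; exact le_top
    · rw [← EReal.coe_toReal htop (hA.l_ne_bot u)] at h1 ⊢
      norm_cast at h1 ⊢
      linarith [neg_le_of_abs_le (hM u)]

end Gradient

/-! ### Dual optimizers -/

section Optimizer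

variable {d : ℕ} {Ω Λ : Set (Vec d)} {q R : ℝ} {F : Vec d → Vec d} {f : Mat d → ℝ}
  {S : Set (SobolevPair d Ω q)}

/-- A conjugate pair `(κ, κ_&)` which, with `φ₀`, optimizes the dual problem at a finite value. -/
structure IsDualOptimizer (Λ : Set (Vec d)) (f : Mat d → ℝ) (F : Vec d → Vec d)
    (S : Set (SobolevPair d Ω q)) (κ : Vec d → ℝ) (φ₀ : SobolevPair d Ω q) : Prop where
  mem : φ₀ ∈ S
  conj : IsConjUp Λ (extDown Λ κ) κ
  ne_top : J Λ f F (fun v => (κ v : EReal)) (extDown Λ κ) φ₀ ≠ ⊤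
  le : ∀ k l : Vec d → EReal, ∀ φ ∈ S, Admissible Λ k l →
    J Λ f F (fun v => (κ v : EReal)) (extDown Λ κ) φ₀ ≤ J Λ f F k l φ

lemma add_add_ne_top {x y z : EReal} (hx : x ≠ ⊥) (hy : y ≠ ⊥) (hz : z ≠ ⊥)
    (h : x + y + z ≠ ⊤) : x ≠ ⊤ ∧ y ≠ ⊤ ∧ z ≠ ⊤ := by
  have hxy : x + y ≠ ⊥ := fun hb => (EReal.add_eq_bot_iff.1 hb).elim hx hy
  have h1 := (EReal.add_ne_top_iff_ne_top₂ hxy hz).1 h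
  have h2 := (EReal.add_ne_top_iff_ne_top₂ hx hy).1 h1.1
  exact ⟨h2.1, h2.2, h1.2⟩

/-- The real form of a finite value of the dual functional. -/
lemma Admissible.J_eq {k l : Vec d → EReal} (h : Admissible Λ k l) (hD : TransportDomains Ω Λ R)
    {φ : SobolevPair d Ω q} (hG : Integrable (fun x => F x + wdiv φ x) (volume.restrict Ω))
    (hJ : J Λ f F k l φ ≠ ⊤) :
    (Integrable (fun x => (k (F x + wdiv φ x)).toReal) (volume.restrict Ω) ∧
      ∀ᵐ x ∂volume.restrict Ω,
        (((k (F x + wdiv φ x)).toReal : ℝ) : EReal) = k (F x + wdiv φ x)) ∧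
    (Integrable (fun u => (l u).toReal) (volume.restrict Λ) ∧
      ∀ᵐ u ∂volume.restrict Λ, (((l u).toReal : ℝ) : EReal) = l u) ∧
    (Integrable (fun x => (legendre f (φ.1 x)).toReal) (volume.restrict Ω) ∧
      ∀ᵐ x ∂volume.restrict Ω,
        (((legendre f (φ.1 x)).toReal : ℝ) : EReal) = legendre f (φ.1 x)) ∧
    J Λ f F k l φ = (((∫ x in Ω, (k (F x + wdiv φ x)).toReal) + (∫ u in Λ, (l u).toReal)
      + ∫ x in Ω, (legendre f (φ.1 x)).toReal : ℝ) : EReal) := by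
  have := hD.isFiniteMeasure_left
  have hk := h.hasIntegrableMinorant_left hD hG
  have hl := h.hasIntegrableMinorant_right hD
  have hφ := hasIntegrableMinorant_legendre (μ := volume.restrict Ω) f φ.1
  have mk : AEMeasurable (fun x => k (F x + wdiv φ x)) (volume.restrict Ω) :=
    h.measurable_k.comp_aemeasurable hG.aemeasurable
  have ml : AEMeasurable l (volume.restrict Λ) := h.measurable_l.aemeasurable
  have mφ := aemeasurable_legendre_fst (f := f) φ
  obtain ⟨h1, h2, h3⟩ := add_add_ne_top hk.bot_lt_eint.ne' hl.bot_lt_eint.ne'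
    hφ.bot_lt_eint.ne' hJ
  refine ⟨hk.integrable_toReal mk h1, hl.integrable_toReal ml h2, hφ.integrable_toReal mφ h3, ?_⟩
  unfold J
  rw [hk.eint_eq_integral mk h1, hl.eint_eq_integral ml h2, hφ.eint_eq_integral mφ h3,
    EReal.coe_add, EReal.coe_add]

/-- Only finiteness of κ_& somewhere on the closure of Λ is at stake. A finite J makes κ_& finite
almost everywhere on Λ, which has positive volume. -/
lemma admissible_extDown_of_J_ne_top (hD : TransportDomains Ω Λ R) {φ : SobolevPair d Ω q}
    (hG : Integrable (fun x => F x + wdiv φ x) (volume.restrict Ω)) {κ : Vec d → ℝ}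
    (hκ : LipschitzWith R.toNNReal κ)
    (hJ : J Λ f F (fun v => (κ v : EReal)) (extDown Λ κ) φ ≠ ⊤) :
    Admissible Λ (fun v => (κ v : EReal)) (extDown Λ κ) := by
  have := hD.isFiniteMeasure_left
  have := hD.isFiniteMeasure_right
  refine admissible_extDown hκ.continuous.measurable ?_
  have hlow : HasIntegrableMinorant (volume.restrict Λ) (extDown Λ κ) := by
    refine hasIntegrableMinorant_of_const (-κ 0) (Eventually.of_forall fun u => ?_)
    by_cases hu : u ∈ closure Λ
    · rw [extDown_of_mem hu]
      simpa using le_conjDown κ u 0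
    · rw [extDown_of_notMem hu]; exact le_top
  unfold J at hJ
  rw [eint_coe (hκ.integrable_comp hG)] at hJ
  obtain ⟨-, h2, -⟩ := add_add_ne_top (EReal.coe_ne_bot _) hlow.bot_lt_eint.ne'
    (hasIntegrableMinorant_legendre (μ := volume.restrict Ω) f φ.1).bot_lt_eint.ne' hJ
  have hml : AEMeasurable (extDown Λ κ) (volume.restrict Λ) := by
    refine (measurable_conjDown κ).aemeasurable.congr ?_
    filter_upwards [hD.ae_mem_closure] with u hu
    rw [extDown_of_mem hu]
  have hae := (hlow.integrable_toReal hml h2).2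
  have := hD.neZero
  obtain ⟨u, hu, huc⟩ := (hae.and hD.ae_mem_closure).exists
  refine ⟨u, huc, ?_⟩
  rw [← extDown_of_mem huc, ← hu]
  exact EReal.coe_ne_top _

lemma J_extDown (hD : TransportDomains Ω Λ R) (φ : SobolevPair d Ω q) (κ : Vec d → ℝ) :
    J Λ f F (fun v => (κ v : EReal)) (extDown Λ κ) φ
      = J Λ f F (fun v => (κ v : EReal)) (conjDown fun v => (κ v : EReal)) φ := by
  unfold J
  rw [eint_congr (μ := volume.restrict Λ) (g := extDown Λ κ)]
  filter_upwards [hD.ae_mem_closure] with u hu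
  rw [extDown_of_mem hu]

namespace IsDualOptimizer

variable {κ : Vec d → ℝ} {φ₀ : SobolevPair d Ω q}

lemma lipschitzWith (h : IsDualOptimizer Λ f F S κ φ₀) (hD : TransportDomains Ω Λ R) :
    LipschitzWith R.toNNReal κ :=
  h.conj.lipschitzWith (extDown_ne_bot κ) hD.nonneg hD.norm_le

lemma admissible (h : IsDualOptimizer Λ f F S κ φ₀) (hD : TransportDomains Ω Λ R)
    (hG : Integrable (fun x => F x + wdiv φ₀ x) (volume.restrict Ω)) :
    Admissible Λ (fun v => (κ v : EReal)) (extDown Λ κ) :=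
  admissible_extDown_of_J_ne_top hD hG (h.lipschitzWith hD) h.ne_top

/-- The Fenchel equality at differentiability points, on which both strong duality and the first
variation rest. -/
lemma mem_closure_and_add_eq (h : IsDualOptimizer Λ f F S κ φ₀) {v g : Vec d} (hg : HasGradientAt κ g v) :
    g ∈ closure Λ ∧ (κ v : EReal) + extDown Λ κ g = ((⟪g, v⟫ : ℝ) : EReal) := by
  have hmem := h.conj.gradient_mem_closure (extDown_ne_bot κ) hg
  refine ⟨hmem, le_antisymm ?_ (h.conj.inner_le (extDown_ne_bot κ) hmem v)⟩
  rw [extDown_of_mem hmem]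
  refine (add_le_add_right (h.conj.gradient_conjDown_le (extDown_ne_bot κ) hg) _).trans ?_
  rw [← EReal.coe_add, add_sub_cancel]

/-- One half of the first-order condition with respect to the potentials. -/
lemma integral_comp_le (h : IsDualOptimizer Λ f F S κ φ₀) (hD : TransportDomains Ω Λ R)
    (hG : Integrable (fun x => F x + wdiv φ₀ x) (volume.restrict Ω)) {u₀ : Vec d → Vec d}
    (hu₀ : ∀ᵐ x ∂volume.restrict Ω, HasGradientAt κ (u₀ x) (F x + wdiv φ₀ x))
    {η : Vec d → ℝ} (hη : Continuous η) {M : ℝ} (hM : ∀ u, |η u| ≤ M) :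
    ∫ x in Ω, η (u₀ x) ≤ ∫ u in Λ, η u := by
  have := hD.isFiniteMeasure_left
  have := hD.isFiniteMeasure_right
  have hA := h.admissible hD hG
  have hbot := extDown_ne_bot (Λ := Λ) κ
  -- The competitors are l + η/(n+1), each paired with its own conjugate.
  have hpert : ∀ n : ℕ, ∃ κ' : Vec d → ℝ,
      IsConjUp Λ (fun u => extDown Λ κ u + ((1 / ((n : ℝ) + 1) * η u : ℝ) : EReal)) κ' ∧
      (∀ v, κ' v ≤ κ v + 1 / ((n : ℝ) + 1) * M) ∧ LipschitzWith R.toNNReal κ' ∧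
      Admissible Λ (fun v => (κ' v : EReal))
        (fun u => extDown Λ κ u + ((1 / ((n : ℝ) + 1) * η u : ℝ) : EReal)) := by
    intro n
    have hB := hA.perturb (h := fun u => 1 / ((n : ℝ) + 1) * η u) (M := 1 / ((n : ℝ) + 1) * M)
      (by fun_prop) (fun u => by
        rw [abs_mul, abs_of_nonneg (by positivity : (0 : ℝ) ≤ 1 / ((n : ℝ) + 1))]
        exact mul_le_mul_of_nonneg_left (hM u) (by positivity))
    obtain ⟨κ', hκ'⟩ := hB.exists_isConjUp hD.norm_le
    have hlip := hκ'.lipschitzWith hB.l_ne_bot hD.nonneg hD.norm_le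
    exact ⟨κ', hκ', fun v => EReal.coe_le_coe_iff.1 (hκ'.le_of_admissible hB v), hlip,
      hB.of_isConjUp hκ' hlip.continuous.measurable⟩
  choose κ' hκ' hκ'le hlip hadm using hpert
  have hηi : Integrable η (volume.restrict Λ) :=
    Integrable.of_bound hη.aestronglyMeasurable M (Eventually.of_forall hM)
  have hκi := (h.lipschitzWith hD).integrable_comp hG
  have hκ'i := fun n => (hlip n).integrable_comp hG
  have hopt : ∀ n : ℕ, ∫ x in Ω, (κ (F x + wdiv φ₀ x) - κ' n (F x + wdiv φ₀ x))
      * ((n : ℝ) + 1) ≤ ∫ u in Λ, η u := by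
    intro n
    have h1 := h.le _ _ φ₀ h.mem (hadm n)
    obtain ⟨-, hl, hφ, -⟩ := hA.J_eq hD hG h.ne_top
    have h2 : eint (volume.restrict Λ)
        (fun u => extDown Λ κ u + ((1 / ((n : ℝ) + 1) * η u : ℝ) : EReal))
        = eint (volume.restrict Λ) (extDown Λ κ)
          + ((∫ u in Λ, 1 / ((n : ℝ) + 1) * η u : ℝ) : EReal) :=
      (hA.hasIntegrableMinorant_right hD).eint_add_coe hA.measurable_l.aemeasurable
        (hηi.const_mul _)
    have h3 : eint (volume.restrict Λ) (extDown Λ κ)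
        = ((∫ u in Λ, (extDown Λ κ u).toReal : ℝ) : EReal) := by
      rw [← eint_coe hl.1]
      exact eint_congr (hl.2.mono fun u hu => hu.symm)
    have h4 : eint (volume.restrict Ω) (fun x => legendre f (φ₀.1 x))
        = ((∫ x in Ω, (legendre f (φ₀.1 x)).toReal : ℝ) : EReal) := by
      rw [← eint_coe hφ.1]
      exact eint_congr (hφ.2.mono fun u hu => hu.symm)
    unfold J at h1
    rw [h2, h3, h4, eint_coe hκi, eint_coe (hκ'i n)] at h1
    norm_cast at h1
    push_cast at h1
    rw [integral_mul_const, integral_sub hκi (hκ'i n)]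
    rw [integral_const_mul] at h1
    have hn : (0 : ℝ) < (n : ℝ) + 1 := by positivity
    rw [← le_div_iff₀ hn]
    have : 1 / ((n : ℝ) + 1) * ∫ u in Λ, η u = (∫ u in Λ, η u) / ((n : ℝ) + 1) := by ring
    linarith
  -- With the reverse bound already obtained, the difference quotients are at most M in absolute
  -- value, which dominates them.
  have hlow : ∀ (n : ℕ) (v : Vec d), κ v - 1 / ((n : ℝ) + 1) * M ≤ κ' n v := by
    intro n v
    have h1 : κ v ≤ κ' n v + 1 / ((n : ℝ) + 1) * M := by
      refine h.conj.le_of_forall hbot fun u hu => ?_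
      have h2 := (hκ' n).inner_le (hadm n).l_ne_bot hu v
      rcases eq_or_ne (extDown Λ κ u) ⊤ with htop | htop
      · rw [htop, EReal.coe_add_top]; exact le_top
      · rw [← EReal.coe_toReal htop (hbot u)] at h2 ⊢
        norm_cast at h2 ⊢
        push_cast at h2 ⊢
        have h3 := mul_le_mul_of_nonneg_left (le_of_abs_le (hM u))
          (by positivity : (0 : ℝ) ≤ 1 / ((n : ℝ) + 1))
        linarith
    linarith
  have hlim : Tendsto (fun n : ℕ => ∫ x in Ω,
      (κ (F x + wdiv φ₀ x) - κ' n (F x + wdiv φ₀ x)) * ((n : ℝ) + 1)) atTop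
      (𝓝 (∫ x in Ω, η (u₀ x))) := by
    refine tendsto_integral_of_dominated_convergence (fun _ => M)
      (fun n => ((hκi.sub (hκ'i n)).mul_const _).1) (integrable_const M)
      (fun n => Eventually.of_forall fun x => ?_) ?_
    · have hn : (0 : ℝ) < (n : ℝ) + 1 := by positivity
      rw [Real.norm_eq_abs, abs_mul, abs_of_pos hn, ← le_div_iff₀ hn, abs_le]
      have h1 := hκ'le n (F x + wdiv φ₀ x)
      have h2 := hlow n (F x + wdiv φ₀ x)
      have : 1 / ((n : ℝ) + 1) * M = M / ((n : ℝ) + 1) := by ring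
      constructor <;> linarith
    -- The quotient tends to η(u₀ x): the lower bound is the envelope estimate, and the upper bound
    -- tests the new pair at u₀ x, where the old pair attains equality.
    · filter_upwards [hu₀] with x hx
      obtain ⟨hmem, heq⟩ := h.mem_closure_and_add_eq hx
      rw [Metric.tendsto_atTop]
      intro ε hε
      obtain ⟨t₀, ht₀, hκt⟩ := h.conj.perturb_le hbot hx hη hM (half_pos hε)
      obtain ⟨N, hN⟩ := exists_nat_one_div_lt ht₀
      refine ⟨N, fun n hnN => ?_⟩
      have hn : (0 : ℝ) < (n : ℝ) + 1 := by positivity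
      have h1 := hκt (1 / ((n : ℝ) + 1)) (by positivity)
        ((one_div_le_one_div_of_le (by positivity) (by
          have : (N : ℝ) ≤ n := by exact_mod_cast hnN
          linarith)).trans_lt hN) _ (hκ' n)
      have h2 : κ (F x + wdiv φ₀ x) ≤ κ' n (F x + wdiv φ₀ x) + 1 / ((n : ℝ) + 1) * η (u₀ x) := by
        have h3 := (hκ' n).inner_le (hadm n).l_ne_bot hmem (F x + wdiv φ₀ x)
        have htop : extDown Λ κ (u₀ x) ≠ ⊤ := fun ht => by
          rw [ht, EReal.coe_add_top] at heq
          exact EReal.coe_ne_top _ heq.symm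
        rw [← heq, ← EReal.coe_toReal htop (hbot _)] at h3
        norm_cast at h3
        push_cast at h3
        linarith
      set a := κ (F x + wdiv φ₀ x)
      set b := κ' n (F x + wdiv φ₀ x)
      have e1 : 1 / ((n : ℝ) + 1) * η (u₀ x) * ((n : ℝ) + 1) = η (u₀ x) := by field_simp
      have e2 : 1 / ((n : ℝ) + 1) * (ε / 2) * ((n : ℝ) + 1) = ε / 2 := by field_simp
      have h5 : (a - b) * ((n : ℝ) + 1) ≤ 1 / ((n : ℝ) + 1) * η (u₀ x) * ((n : ℝ) + 1) :=
        mul_le_mul_of_nonneg_right (by linarith) hn.le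
      have h6 : (1 / ((n : ℝ) + 1) * η (u₀ x) - 1 / ((n : ℝ) + 1) * (ε / 2)) * ((n : ℝ) + 1)
          ≤ (a - b) * ((n : ℝ) + 1) :=
        mul_le_mul_of_nonneg_right (by linarith) hn.le
      rw [Real.dist_eq, abs_lt]
      constructor <;> linarith
  exact le_of_tendsto hlim (Eventually.of_forall hopt)

/-- The one-sided condition for both η and -η. -/
lemma integral_comp_eq (h : IsDualOptimizer Λ f F S κ φ₀) (hD : TransportDomains Ω Λ R)
    (hG : Integrable (fun x => F x + wdiv φ₀ x) (volume.restrict Ω)) {u₀ : Vec d → Vec d}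
    (hu₀ : ∀ᵐ x ∂volume.restrict Ω, HasGradientAt κ (u₀ x) (F x + wdiv φ₀ x))
    {η : Vec d → ℝ} (hη : Continuous η) {M : ℝ} (hM : ∀ u, |η u| ≤ M) :
    ∫ x in Ω, η (u₀ x) = ∫ u in Λ, η u := by
  refine le_antisymm (h.integral_comp_le hD hG hu₀ hη hM) ?_
  have := h.integral_comp_le hD hG hu₀ (η := fun u => -η u) (by fun_prop) (M := M)
    (fun u => by rw [abs_neg]; exact hM u)
  rw [integral_neg, integral_neg] at this
  linarith

end IsDualOptimizer

end Optimizer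

/-! ### Growth of f*, the pairing, and weak duality -/

section Duality

variable {d : ℕ} {Ω Λ : Set (Vec d)} {q R : ℝ} {F : Vec d → Vec d} {f : Mat d → ℝ}
  {S : Set (SobolevPair d Ω q)}

/-! ### Superlinear growth of the Legendre transform -/

lemma legendre_superlinear {p c b : ℝ} (hp : 0 < p) (hc : 0 < c)
    (hf : ∀ ξ : Mat d, f ξ ≤ c * ‖ξ‖ ^ p / p + b) (K : ℝ) :
    ∃ C : ℝ, ∀ y, ((K * ‖y‖ - C : ℝ) : EReal) ≤ legendre f y := by
  refine ⟨c * |K| ^ p / p + b, fun y => ?_⟩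
  -- The supremum is tested at the multiple of y of length |K|; for y = 0 division by zero makes the
  -- test point 0, and the estimate still holds.
  refine le_trans ?_ (le_legendre f ((K / ‖y‖) • y) y)
  rw [EReal.coe_le_coe_iff, real_inner_smul_left, real_inner_self_eq_norm_sq]
  have h1 : K / ‖y‖ * ‖y‖ ^ 2 = K * ‖y‖ := by
    rcases eq_or_ne ‖y‖ 0 with h0 | h0
    · rw [h0]; simp
    · field_simp
  have h2 : ‖(K / ‖y‖) • y‖ ≤ |K| := by
    rw [norm_smul, norm_div, norm_norm, Real.norm_eq_abs]
    rcases eq_or_ne ‖y‖ 0 with h0 | h0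
    · rw [h0, mul_zero]; exact abs_nonneg _
    · rw [div_mul_cancel₀ _ h0]
  have h3 := hf ((K / ‖y‖) • y)
  have h4 : c * ‖(K / ‖y‖) • y‖ ^ p / p ≤ c * |K| ^ p / p := by
    gcongr
  linarith

lemma legendre_segment_le {x y : Mat d} {a b t : ℝ} (ha : legendre f x = a) (hb : legendre f y = b)
    (ht0 : 0 ≤ t) (ht1 : t ≤ 1) : legendre f (x + t • (y - x)) ≤ ((a + t * (b - a) : ℝ) : EReal) := by
  refine iSup_le fun z => ?_
  have h1 := le_legendre f z x
  have h2 := le_legendre f z y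
  rw [ha, EReal.coe_le_coe_iff] at h1
  rw [hb, EReal.coe_le_coe_iff] at h2
  rw [EReal.coe_le_coe_iff, inner_add_right, inner_smul_right, inner_sub_right]
  nlinarith [mul_le_mul_of_nonneg_left h2 ht0, mul_le_mul_of_nonneg_left h1 (sub_nonneg.2 ht1)]

/-! ### The pairing -/

lemma integrable_inner_of_norm_le {X : Type*} [MeasurableSpace X] {μ : Measure X}
    {E : Type*} [NormedAddCommGroup E] [InnerProductSpace ℝ E] {u w : X → E} {C : ℝ}
    (hu : AEStronglyMeasurable u μ) (hC : ∀ᵐ x ∂μ, ‖u x‖ ≤ C) (hw : Integrable w μ) :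
    Integrable (fun x => ⟪u x, w x⟫) μ := by
  refine Integrable.mono' (hw.norm.const_mul C) (hu.inner hw.1) ?_
  filter_upwards [hC] with x hx
  exact (norm_inner_le_norm _ _).trans (mul_le_mul_of_nonneg_right hx (norm_nonneg _))

lemma pairing_eq (hD : TransportDomains Ω Λ R) {u : Vec d → Vec d} {φ : SobolevPair d Ω q}
    (hu : Integrable (fun x => ⟪u x, wdiv φ x⟫) (volume.restrict Ω)) :
    pairing f u φ = ((-∫ x in Ω, ⟪u x, wdiv φ x⟫ : ℝ) : EReal)
      - eint (volume.restrict Ω) (fun x => legendre f (φ.1 x)) := by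
  have := hD.isFiniteMeasure_left
  unfold pairing
  rw [(hasIntegrableMinorant_legendre f φ.1).eint_coe_sub (aemeasurable_legendre_fst φ)
    (w := fun x => -⟪u x, wdiv φ x⟫) hu.neg, integral_neg]

/-! ### Measure-preserving maps and weak duality -/

/-- Finite measures on ℝ^d are determined by their integrals of compactly supported continuous
functions. -/
lemma US1.map_eq {u : Vec d → Vec d} (hu : u ∈ US1 Λ S) (hD : TransportDomains Ω Λ R) :
    (volume.restrict Ω).map u = volume.restrict Λ := by
  have := hD.isFiniteMeasure_left
  have := hD.isFiniteMeasure_right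
  refine Measure.ext_of_integral_eq_on_compactlySupported fun l => ?_
  exact (integral_map hu.1.1 l.continuous.aestronglyMeasurable).trans
    (hu.2 l l.continuous l.hasCompactSupport)

lemma US1.ae_norm_le {u : Vec d → Vec d} (hu : u ∈ US1 Λ S) (hD : TransportDomains Ω Λ R) :
    ∀ᵐ x ∂volume.restrict Ω, ‖u x‖ ≤ R :=
  hu.1.2.1.mono fun _ hx => hD.norm_le _ hx

/-- Weak duality, with the equality case. -/
lemma US1.integral_inner_le {u : Vec d → Vec d} (hu : u ∈ US1 Λ S) (hD : TransportDomains Ω Λ R)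
    {k l : Vec d → EReal} (hA : Admissible Λ k l) {φ : SobolevPair d Ω q}
    (hG : Integrable (fun x => F x + wdiv φ x) (volume.restrict Ω)) (hJ : J Λ f F k l φ ≠ ⊤) :
    ∫ x in Ω, ⟪u x, F x + wdiv φ x⟫
        ≤ (∫ x in Ω, (k (F x + wdiv φ x)).toReal) + ∫ y in Λ, (l y).toReal ∧
    ((∫ x in Ω, (k (F x + wdiv φ x)).toReal) + (∫ y in Λ, (l y).toReal)
        ≤ ∫ x in Ω, ⟪u x, F x + wdiv φ x⟫ →
      ∀ᵐ x ∂volume.restrict Ω,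
        k (F x + wdiv φ x) + l (u x) = ((⟪u x, F x + wdiv φ x⟫ : ℝ) : EReal)) := by
  obtain ⟨⟨hk, hk'⟩, ⟨hl, hl'⟩, -, -⟩ := hA.J_eq hD hG hJ
  have hmap := US1.map_eq hu hD
  have hum := hu.1.1
  rw [← hmap] at hl hl' ⊢
  have hlu : Integrable (fun x => (l (u x)).toReal) (volume.restrict Ω) :=
    hl.comp_aemeasurable hum
  have hlu' := ae_of_ae_map hum hl'
  rw [integral_map hum hl.1]
  have hin := integrable_inner_of_norm_le hum.aestronglyMeasurable (US1.ae_norm_le hu hD) hG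
  have hnn : 0 ≤ᵐ[volume.restrict Ω] fun x => (k (F x + wdiv φ x)).toReal + (l (u x)).toReal
      - ⟪u x, F x + wdiv φ x⟫ := by
    filter_upwards [hk', hlu'] with x h1 h2
    have h3 := hA.ineq (u x) (F x + wdiv φ x)
    rw [← h1, ← h2] at h3
    norm_cast at h3
    simpa using h3
  have hsum : Integrable (fun x => (k (F x + wdiv φ x)).toReal + (l (u x)).toReal)
      (volume.restrict Ω) := hk.add hlu
  have hint : ∫ x in Ω, ((k (F x + wdiv φ x)).toReal + (l (u x)).toReal
      - ⟪u x, F x + wdiv φ x⟫) = (∫ x in Ω, (k (F x + wdiv φ x)).toReal)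
        + (∫ x in Ω, (l (u x)).toReal) - ∫ x in Ω, ⟪u x, F x + wdiv φ x⟫ := by
    rw [integral_sub hsum hin, integral_add hk hlu]
  have h0 := integral_nonneg_of_ae hnn
  rw [hint] at h0
  refine ⟨by linarith, fun hle => ?_⟩
  -- Equality of the integrals makes the nonnegative gap integrate to zero, so it vanishes almost
  -- everywhere.
  have hz := (integral_eq_zero_iff_of_nonneg_ae hnn (hsum.sub hin)).1 (by
    rw [hint]; linarith)
  filter_upwards [hk', hlu', hz] with x h1 h2 h3
  rw [← h1, ← h2, ← EReal.coe_add, EReal.coe_eq_coe_iff]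
  simp only [Pi.zero_apply] at h3
  linarith

end Duality

section Main

variable {d : ℕ} {Ω Λ : Set (Vec d)} {q R : ℝ} {F : Vec d → Vec d} {f : Mat d → ℝ}
  [Fact (1 ≤ ENNReal.ofReal q)] {S : Set (SobolevPair d Ω q)}

/-! ### Existence of a normalized dual optimizer -/

/-- The reduction to conjugate pairs is used twice: on the minimizer, to make κ the conjugate of its
own conjugate, and on each competitor, to bring it into the class minimized over. -/
lemma exists_isDualOptimizer (hD : TransportDomains Ω Λ R) (hF : Integrable F (volume.restrict Ω))
    (hS : S ⊆ W0 d Ω q) (hScl : IsClosed S) [FiniteDimensional ℝ (Submodule.span ℝ S)]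
    (hf : ∀ K : ℝ, ∃ C : ℝ, ∀ y, ((K * ‖y‖ - C : ℝ) : EReal) ≤ legendre f y)
    (hfin : (finitePart f S).Nonempty) :
    ∃ κ φ₀, IsDualOptimizer Λ f F S κ φ₀ ∧ κ 0 = 0 := by
  obtain ⟨κ₁, φ₀, hφ₀, hlip, h0, htop, hmin⟩ := exists_minimizer hD hF hS hScl hf hfin
  have hG : ∀ φ : SobolevPair d Ω q, Integrable (fun x => F x + wdiv φ x) (volume.restrict Ω) :=
    integrable_field hD hF
  have hA := admissible_extDown_of_J_ne_top hD (hG φ₀) hlip (by rwa [J_extDown hD])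
  obtain ⟨κ, hκ, hκ0, hconj, hle⟩ := hA.exists_isConjUp_J_le (f := f) hD φ₀ (hG φ₀)
  rw [J_extDown hD] at hle
  refine ⟨κ, φ₀, ⟨hφ₀, fun v => (hconj v).trans (conjUp_extDown κ v).symm, ?_, ?_⟩, hκ0⟩
  · rw [J_extDown hD]
    exact (hle.trans_lt htop.lt_top).ne
  · intro k l φ hφ hkl
    obtain ⟨κ', hκ', hκ'0, -, hle'⟩ := hkl.exists_isConjUp_J_le (f := f) hD φ (hG φ)
    rw [J_extDown hD]
    exact hle.trans ((hmin κ' hκ' hκ'0 φ hφ).trans hle')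

/-! ### The first-order condition in the divergence variable -/

namespace IsDualOptimizer

variable {κ : Vec d → ℝ} {φ₀ : SobolevPair d Ω q}

/-- Optimality along the segment from φ₀ to ψ, with the potentials frozen. The κ-term is
differentiated, its derivative being u₀ paired with the change of divergence; the f*-term is only
bounded by convexity, so f* need not be differentiable. -/
lemma mem_PhiS (h : IsDualOptimizer Λ f F S κ φ₀) (hD : TransportDomains Ω Λ R)
    (hF : Integrable F (volume.restrict Ω)) (hScv : Convex ℝ S) {u₀ : Vec d → Vec d}
    (hu₀m : AEMeasurable u₀ (volume.restrict Ω))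
    (hu₀R : ∀ᵐ x ∂volume.restrict Ω, ‖u₀ x‖ ≤ R)
    (hu₀ : ∀ᵐ x ∂volume.restrict Ω, HasGradientAt κ (u₀ x) (F x + wdiv φ₀ x)) :
    φ₀ ∈ PhiS f S u₀ := by
  have := hD.isFiniteMeasure_left
  refine ⟨h.mem, fun ψ hψ => ?_⟩
  have hG := integrable_field hD hF φ₀
  have hlip := h.lipschitzWith hD
  have hin : ∀ φ : SobolevPair d Ω q,
      Integrable (fun x => ⟪u₀ x, wdiv φ x⟫) (volume.restrict Ω) := fun φ =>
    integrable_inner_of_norm_le hu₀m.aestronglyMeasurable hu₀R (integrable_wdiv φ)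
  rw [pairing_eq hD (hin ψ), pairing_eq hD (hin φ₀)]
  by_cases hψt : eint (volume.restrict Ω) (fun x => legendre f (ψ.1 x)) = ⊤
  · rw [hψt, EReal.sub_top]; exact bot_le
  obtain ⟨-, hl, hφ, -⟩ := (h.admissible hD hG).J_eq hD hG h.ne_top
  have hψm := hasIntegrableMinorant_legendre (μ := volume.restrict Ω) f ψ.1
  obtain ⟨hψi, hψe⟩ := hψm.integrable_toReal (aemeasurable_legendre_fst ψ) hψt
  rw [hψm.eint_eq_integral (aemeasurable_legendre_fst ψ) hψt]
  have hφe : eint (volume.restrict Ω) (fun x => legendre f (φ₀.1 x))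
      = ((∫ x in Ω, (legendre f (φ₀.1 x)).toReal : ℝ) : EReal) := by
    rw [← eint_coe hφ.1]
    exact eint_congr (hφ.2.mono fun x hx => hx.symm)
  have hle : eint (volume.restrict Λ) (extDown Λ κ)
      = ((∫ u in Λ, (extDown Λ κ u).toReal : ℝ) : EReal) := by
    rw [← eint_coe hl.1]
    exact eint_congr (hl.2.mono fun u hu => hu.symm)
  rw [hφe]
  set a := ∫ x in Ω, (legendre f (φ₀.1 x)).toReal
  set b := ∫ x in Ω, (legendre f (ψ.1 x)).toReal
  set w : Vec d → Vec d := fun x => wdiv ψ x - wdiv φ₀ x with hw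
  have hwi : Integrable w (volume.restrict Ω) := (integrable_wdiv ψ).sub (integrable_wdiv φ₀)
  set t : ℕ → ℝ := fun n => 1 / ((n : ℝ) + 1) with ht
  have ht0 : ∀ n, 0 < t n := fun n => by positivity
  have ht1 : ∀ n, t n ≤ 1 := fun n => by
    rw [ht]
    exact div_le_one_of_le₀ (by linarith [n.cast_nonneg (α := ℝ)]) (by positivity)
  have hκi := hlip.integrable_comp hG
  have hκti : ∀ n, Integrable (fun x => κ (F x + wdiv φ₀ x + t n • w x)) (volume.restrict Ω) :=
    fun n => hlip.integrable_comp (hG.add (hwi.smul (t n)))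
  have hopt : ∀ n : ℕ, ∫ x in Ω, ((n : ℝ) + 1) • (κ (F x + wdiv φ₀ x)
      - κ (F x + wdiv φ₀ x + t n • w x)) ≤ b - a := by
    intro n
    have hmem : φ₀ + t n • (ψ - φ₀) ∈ S :=
      hScv.add_smul_sub_mem h.mem hψ ⟨(ht0 n).le, ht1 n⟩
    have h1 := h.le _ _ _ hmem (h.admissible hD hG)
    have h2 : eint (volume.restrict Ω)
        (fun x => (κ (F x + wdiv (φ₀ + t n • (ψ - φ₀)) x) : EReal))
        = ((∫ x in Ω, κ (F x + wdiv φ₀ x + t n • w x) : ℝ) : EReal) := by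
      rw [← eint_coe (hκti n)]
      refine eint_congr ?_
      filter_upwards [wdiv_segment φ₀ ψ (t n)] with x hx
      rw [hx, ← add_assoc]
    have h3 : eint (volume.restrict Ω) (fun x => legendre f ((φ₀ + t n • (ψ - φ₀)).1 x))
        ≤ ((a + t n * (b - a) : ℝ) : EReal) := by
      have hs : Integrable (fun x => t n * ((legendre f (ψ.1 x)).toReal
          - (legendre f (φ₀.1 x)).toReal)) (volume.restrict Ω) := (hψi.sub hφ.1).const_mul _
      have hi : Integrable (fun x => (legendre f (φ₀.1 x)).toReal + t n *
          ((legendre f (ψ.1 x)).toReal - (legendre f (φ₀.1 x)).toReal)) (volume.restrict Ω) :=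
        hφ.1.add hs
      have e : ∫ x in Ω, ((legendre f (φ₀.1 x)).toReal + t n *
          ((legendre f (ψ.1 x)).toReal - (legendre f (φ₀.1 x)).toReal)) = a + t n * (b - a) := by
        rw [integral_add hφ.1 hs, integral_const_mul,
          integral_sub hψi hφ.1]
      rw [← e, ← eint_coe hi]
      refine eint_mono ?_
      filter_upwards [fst_segment φ₀ ψ (t n), hφ.2, hψe] with x hx hx1 hx2
      rw [hx]
      exact legendre_segment_le hx1.symm hx2.symm (ht0 n).le (ht1 n)
    unfold J at h1
    rw [h2, hle, hφe, eint_coe hκi] at h1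
    have h4 := h1.trans (add_le_add_right h3 _)
    norm_cast at h4
    rw [integral_smul, integral_sub hκi (hκti n), smul_eq_mul]
    have hn : (0 : ℝ) < (n : ℝ) + 1 := by positivity
    rw [← le_div_iff₀' hn]
    have : t n * (b - a) = (b - a) / ((n : ℝ) + 1) := by rw [ht]; ring
    linarith
  have hlim : Tendsto (fun n : ℕ => ∫ x in Ω, ((n : ℝ) + 1) • (κ (F x + wdiv φ₀ x)
      - κ (F x + wdiv φ₀ x + t n • w x))) atTop (𝓝 (∫ x in Ω, -⟪u₀ x, w x⟫)) := by
    -- The Lipschitz bound dominates the difference quotients, and they converge wherever κ is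
    -- differentiable.
    refine tendsto_integral_of_dominated_convergence (fun x => R.toNNReal * ‖w x‖)
      (fun n => ((hκi.sub (hκti n)).smul ((n : ℝ) + 1)).1) (hwi.norm.const_mul _)
      (fun n => Eventually.of_forall fun x => ?_) ?_
    · have hn : (0 : ℝ) < (n : ℝ) + 1 := by positivity
      have h1 := hlip.dist_le_mul (F x + wdiv φ₀ x) (F x + wdiv φ₀ x + t n • w x)
      rw [dist_self_add_right, norm_smul, Real.norm_of_nonneg (ht0 n).le] at h1
      rw [norm_smul, Real.norm_of_nonneg hn.le, ← dist_eq_norm]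
      refine (mul_le_mul_of_nonneg_left h1 hn.le).trans (le_of_eq ?_)
      rw [ht]
      field_simp
    · filter_upwards [hu₀] with x hx
      have hc : Tendsto (fun n : ℕ => ‖(n : ℝ) + 1‖) atTop atTop :=
        tendsto_norm_atTop_atTop.comp
          (tendsto_atTop_add_const_right _ _ tendsto_natCast_atTop_atTop)
      have := (hx.hasFDerivAt.lim (w x) hc).neg
      rw [InnerProductSpace.toDual_apply_apply] at this
      refine this.congr fun n => ?_
      simp only [ht, one_div, ← smul_neg, neg_sub]
  have hfinal := le_of_tendsto hlim (Eventually.of_forall hopt)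
  have e : ∫ x in Ω, -⟪u₀ x, w x⟫
      = (∫ x in Ω, ⟪u₀ x, wdiv φ₀ x⟫) - ∫ x in Ω, ⟪u₀ x, wdiv ψ x⟫ := by
    rw [← integral_sub (hin φ₀) (hin ψ)]
    congr 1
    funext x
    rw [hw, inner_sub_right]
    ring
  rw [e] at hfinal
  norm_cast
  linarith

/-- By Rademacher's theorem the non-differentiability set of κ is null, and non-degeneracy pulls it
back to a null set. -/
lemma exists_gradient (h : IsDualOptimizer Λ f F S κ φ₀) (hD : TransportDomains Ω Λ R)
    (hF : Integrable F (volume.restrict Ω))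
    (hND : Nondegenerate Ω (fun x => F x + wdiv φ₀ x)) :
    ∃ u₀ : Vec d → Vec d, AEMeasurable u₀ (volume.restrict Ω) ∧
      ∀ᵐ x ∂volume.restrict Ω, HasGradientAt κ (u₀ x) (F x + wdiv φ₀ x) := by
  have hm : Measurable (gradient κ) :=
    (InnerProductSpace.toDual ℝ (Vec d)).symm.continuous.measurable.comp (measurable_fderiv ℝ κ)
  refine ⟨fun x => gradient κ (F x + wdiv φ₀ x),
    hm.comp_aemeasurable (integrable_field hD hF φ₀).aemeasurable, ?_⟩
  have h0 := hND {v | ¬DifferentiableAt ℝ κ v} (h.lipschitzWith hD).ae_differentiableAt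
  rw [ae_restrict_iff' hD.measurableSet, ae_iff]
  refine measure_mono_null (fun x hx => ?_) h0
  simp only [mem_ofPred_eq, Classical.not_imp] at hx
  exact ⟨hx.1, fun hdiff => hx.2 hdiff.hasGradientAt⟩

/-- The gradient of the optimal potential along the optimal field is feasible. -/
lemma mem_US1 (h : IsDualOptimizer Λ f F S κ φ₀) (hD : TransportDomains Ω Λ R)
    (hF : Integrable F (volume.restrict Ω)) (hS : S ⊆ W0 d Ω q)
    [FiniteDimensional ℝ (Submodule.span ℝ S)] {u₀ : Vec d → Vec d}
    (hu₀m : AEMeasurable u₀ (volume.restrict Ω))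
    (hu₀ : ∀ᵐ x ∂volume.restrict Ω, HasGradientAt κ (u₀ x) (F x + wdiv φ₀ x)) :
    u₀ ∈ US1 Λ S := by
  have := hD.isFiniteMeasure_left
  have hmem : ∀ᵐ x ∂volume.restrict Ω, u₀ x ∈ closure Λ :=
    hu₀.mono fun x hx => (h.mem_closure_and_add_eq hx).1
  refine ⟨⟨hu₀m, hmem, ?_⟩, fun l hl hlc => ?_⟩
  · obtain ⟨C, hC, hnorm⟩ := exists_norm_le_integral_norm_fst hS
    set M := ‖divL1 (Ω := Ω) (q := q)‖
    set L := ‖lpToL1 (E := Mat d) (volume.restrict Ω) (ENNReal.ofReal q)‖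
    have hR := hD.nonneg
    -- The divergence is controlled by the L^q norm of φ itself, through the norm equivalence on the
    -- span of S; the 1 only makes the constant positive.
    refine ⟨R * (M * (C * L)) + 1, by positivity, fun φ hφ => ?_⟩
    have h1 : |∫ x in Ω, ⟪u₀ x, wdiv φ x⟫| ≤ R * ‖divL1 φ‖ := by
      have hi : Integrable (fun x => R * ‖wdiv φ x‖) (volume.restrict Ω) :=
        (integrable_wdiv φ).norm.const_mul R
      rw [← integral_norm_wdiv, ← integral_const_mul, ← Real.norm_eq_abs]
      refine norm_integral_le_of_norm_le hi ?_
      filter_upwards [hmem] with x hx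
      exact (norm_inner_le_norm _ _).trans
        (mul_le_mul_of_nonneg_right (hD.norm_le _ hx) (norm_nonneg _))
    have h2 : ‖divL1 φ‖ ≤ M * ‖φ‖ := (divL1 (Ω := Ω) (q := q)).le_opNorm φ
    have h3 : ‖φ‖ ≤ C * ‖fstL1 φ‖ := by
      rw [← integral_norm_fst]
      exact hnorm φ (Submodule.subset_span hφ)
    have h4 : ‖fstL1 φ‖ ≤ L * ‖φ.1‖ :=
      (lpToL1 (volume.restrict Ω) (ENNReal.ofReal q)).le_opNorm φ.1
    calc |∫ x in Ω, ⟪u₀ x, wdiv φ x⟫| ≤ R * (M * (C * (L * ‖φ.1‖))) := by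
          refine h1.trans (mul_le_mul_of_nonneg_left (h2.trans ?_) hR)
          refine mul_le_mul_of_nonneg_left (h3.trans ?_) (norm_nonneg (divL1 (Ω := Ω) (q := q)))
          exact mul_le_mul_of_nonneg_left h4 hC.le
      _ ≤ (R * (M * (C * L)) + 1) * ‖φ.1‖ := by
          have := norm_nonneg φ.1
          nlinarith
  · obtain ⟨M, hM⟩ := hl.bounded_above_of_compact_support hlc
    exact h.integral_comp_eq hD (integrable_field hD hF φ₀) hu₀ hl hM

end IsDualOptimizer

end Main

/-! ### Continuous admissible potentials -/

section Continuous

variable {d : ℕ} {Ω Λ : Set (Vec d)} {q R : ℝ} {F : Vec d → Vec d} {f : Mat d → ℝ}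
  {S : Set (SobolevPair d Ω q)}

open Classical in
/-- The extension by `∞` of a function on `Λ̄`. -/
def extTop (Λ : Set (Vec d)) (l : Vec d → ℝ) (u : Vec d) : EReal :=
  if u ∈ closure Λ then (l u : EReal) else ⊤

lemma extTop_of_mem {l : Vec d → ℝ} {u : Vec d} (hu : u ∈ closure Λ) :
    extTop Λ l u = l u := if_pos hu

lemma extTop_of_notMem {l : Vec d → ℝ} {u : Vec d} (hu : u ∉ closure Λ) :
    extTop Λ l u = ⊤ := if_neg hu

lemma J_extTop (hD : TransportDomains Ω Λ R) (φ : SobolevPair d Ω q) (k : Vec d → EReal)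
    (l : Vec d → ℝ) : J Λ f F k (extTop Λ l) φ = J Λ f F k (fun u => (l u : EReal)) φ := by
  unfold J
  rw [eint_congr (μ := volume.restrict Λ) (g := extTop Λ l)]
  filter_upwards [hD.ae_mem_closure] with u hu
  rw [extTop_of_mem hu]

lemma admissible_extTop {k l : Vec d → ℝ} (hk : Measurable k) (hl : ContinuousOn l (closure Λ))
    (hne : (closure Λ).Nonempty) (h : ∀ u ∈ closure Λ, ∀ v, ⟪u, v⟫ ≤ k v + l u) :
    Admissible Λ (fun v => (k v : EReal)) (extTop Λ l) where
  measurable_k := measurable_coe_real_ereal.comp hk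
  measurable_l := by
    classical
    exact ContinuousOn.measurable_piecewise (f := fun u => (l u : EReal)) (g := fun _ => ⊤)
      (continuous_coe_real_ereal.comp_continuousOn hl) continuousOn_const
      isClosed_closure.measurableSet
  k_ne_bot v := EReal.coe_ne_bot _
  l_ne_bot u := by
    by_cases hu : u ∈ closure Λ
    · rw [extTop_of_mem hu]; exact EReal.coe_ne_bot _
    · rw [extTop_of_notMem hu]; exact top_ne_bot
  k_finite := ⟨0, EReal.coe_ne_top _⟩
  l_finite := by
    obtain ⟨u, hu⟩ := hne
    exact ⟨u, by rw [extTop_of_mem hu]; exact EReal.coe_ne_top _⟩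
  l_top u hu := extTop_of_notMem hu
  ineq u v := by
    by_cases hu : u ∈ closure Λ
    · rw [extTop_of_mem hu, ← EReal.coe_add, EReal.coe_le_coe_iff]
      exact h u hu v
    · rw [extTop_of_notMem hu, EReal.coe_add_top]; exact le_top

lemma ContAdmissible.admissible_extTop {k l : Vec d → ℝ} (h : ContAdmissible Λ k l)
    (hne : Λ.Nonempty) : Admissible Λ (fun v => (k v : EReal)) (extTop Λ l) :=
  _root_.admissible_extTop h.measurable_k h.continuous_l hne.closure fun u hu v =>
    ContinuousWithinAt.closure_le hu (f := fun u => ⟪u, v⟫) (g := fun u => k v + l u)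
      (by fun_prop) (continuousWithinAt_const.add ((h.continuous_l u hu).mono subset_closure))
      fun u hu => h.ineq u hu v

/-- The conjugate of `κ` with the supremum restricted to the ball of radius `s`. -/
def truncConj (κ : Vec d → ℝ) (s : ℝ) (u : Vec d) : ℝ :=
  ⨆ v : Metric.closedBall (0 : Vec d) s, (⟪u, (v : Vec d)⟫ - κ v)

lemma bddAbove_truncConj {κ : Vec d → ℝ} (hκ : Continuous κ) (s : ℝ) (u : Vec d) :
    BddAbove (range fun v : Metric.closedBall (0 : Vec d) s => ⟪u, (v : Vec d)⟫ - κ v) := by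
  have := (isCompact_closedBall (0 : Vec d) s).bddAbove_image
    (f := fun v => ⟪u, v⟫ - κ v) (by fun_prop)
  rwa [image_eq_range] at this

lemma le_truncConj {κ : Vec d → ℝ} (hκ : Continuous κ) {s : ℝ} (u : Vec d) {v : Vec d}
    (hv : ‖v‖ ≤ s) : ⟪u, v⟫ - κ v ≤ truncConj κ s u :=
  le_ciSup (bddAbove_truncConj hκ s u) ⟨v, mem_closedBall_zero_iff.2 hv⟩

lemma truncConj_le {κ : Vec d → ℝ} {s : ℝ} (hs : 0 ≤ s) {u : Vec d} {c : ℝ}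
    (hc : ∀ v, ‖v‖ ≤ s → ⟪u, v⟫ - κ v ≤ c) : truncConj κ s u ≤ c := by
  have : Nonempty (Metric.closedBall (0 : Vec d) s) := ⟨⟨0, Metric.mem_closedBall_self hs⟩⟩
  exact ciSup_le fun v => hc v (mem_closedBall_zero_iff.1 v.2)

lemma continuous_truncConj {κ : Vec d → ℝ} (hκ : Continuous κ) {s : ℝ} (hs : 0 ≤ s) :
    Continuous (truncConj κ s) := by
  refine (LipschitzWith.of_le_add_mul' s fun u w => truncConj_le hs fun v hv => ?_).continuous
  have h1 := le_truncConj hκ w hv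
  have h2 : ⟪u, v⟫ = ⟪w, v⟫ + ⟪u - w, v⟫ := by rw [inner_sub_left]; ring
  have h3 := (real_inner_le_norm (u - w) v).trans
    (mul_le_mul_of_nonneg_left hv (norm_nonneg (u - w)))
  rw [dist_eq_norm]
  linarith

/-- The dual optimal value is approached by continuous admissible potentials. -/
lemma IsDualOptimizer.exists_contAdmissible {κ : Vec d → ℝ} {φ₀ : SobolevPair d Ω q}
    (h : IsDualOptimizer Λ f F S κ φ₀) (h0 : κ 0 = 0) (hD : TransportDomains Ω Λ R)
    (hne : Λ.Nonempty) (hG : Integrable (fun x => F x + wdiv φ₀ x) (volume.restrict Ω)) :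
    ∃ (k l : ℕ → Vec d → ℝ) (c : ℕ → ℝ), (∀ n, ContAdmissible Λ (k n) (l n)) ∧
      (∀ n, J Λ f F (fun v => (k n v : EReal)) (fun u => (l n u : EReal)) φ₀ ≤ c n) ∧
      Tendsto (fun n => (c n : EReal)) atTop
        (𝓝 (J Λ f F (fun v => (κ v : EReal)) (extDown Λ κ) φ₀)) := by
  have := hD.isFiniteMeasure_left
  have hlip := h.lipschitzWith hD
  have hκc := hlip.continuous
  -- The conjugate κ_& may be infinite on parts of the closure of Λ; restricting its supremum to a
  -- ball gives a continuous real function below it.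
  set l : ℕ → Vec d → ℝ := fun n => truncConj κ n with hl
  have hl0 : ∀ n u, 0 ≤ l n u := fun n u => by
    have := le_truncConj hκc (s := n) u (v := 0) (by simp)
    rwa [h0, inner_zero_right, sub_zero] at this
  have hlc : ∀ n, Continuous (l n) := fun n => continuous_truncConj hκc n.cast_nonneg
  have hlext : ∀ n, ∀ u ∈ closure Λ, (l n u : EReal) ≤ extDown Λ κ u := by
    intro n u hu
    rw [extDown_of_mem hu]
    rcases eq_or_ne (conjDown (fun v => (κ v : EReal)) u) ⊤ with ht | ht
    · rw [ht]; exact le_top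
    · rw [← EReal.coe_toReal ht (conjDown_ne_bot κ u), EReal.coe_le_coe_iff]
      refine truncConj_le n.cast_nonneg fun v _ => ?_
      have := le_conjDown κ u v
      rwa [← EReal.coe_toReal ht (conjDown_ne_bot κ u), EReal.coe_le_coe_iff] at this
  have hadm : ∀ n, Admissible Λ (fun v => ((R * ‖v‖ : ℝ) : EReal)) (extTop Λ (l n)) := fun n =>
    admissible_extTop (by fun_prop) (hlc n).continuousOn hne.closure fun u hu v => by
      have := (real_inner_le_norm u v).trans
        (mul_le_mul_of_nonneg_right (hD.norm_le u hu) (norm_nonneg v))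
      linarith [hl0 n u]
  choose k hk using fun n => (hadm n).exists_isConjUp hD.norm_le
  have hbot := fun n => (hadm n).l_ne_bot
  have hklip : ∀ n, LipschitzWith R.toNNReal (k n) := fun n =>
    (hk n).lipschitzWith (hbot n) hD.nonneg hD.norm_le
  have hineq : ∀ n, ∀ u ∈ closure Λ, ∀ v, ⟪u, v⟫ ≤ k n v + l n u := by
    intro n u hu v
    have := (hk n).inner_le (hbot n) hu v
    rwa [extTop_of_mem hu, ← EReal.coe_add, EReal.coe_le_coe_iff] at this
  have hkle : ∀ n (c : ℝ) v, (∀ u ∈ closure Λ, ⟪u, v⟫ ≤ c + l n u) → k n v ≤ c := by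
    intro n c v hc
    refine (hk n).le_of_forall (hbot n) fun u hu => ?_
    rw [extTop_of_mem hu, ← EReal.coe_add, EReal.coe_le_coe_iff]
    exact hc u hu
  have hge : ∀ n v, κ v ≤ k n v := by
    intro n v
    refine h.conj.le_of_forall (extDown_ne_bot κ) fun u hu => ?_
    exact (EReal.coe_le_coe_iff.2 (hineq n u hu v)).trans
      ((EReal.coe_add _ _).le.trans (add_le_add_right (hlext n u hu) _))
  -- For v in the ball, l_n(u) ≥ u·v - κ(v) by construction, so the truncation is not felt by the
  -- conjugate there.
  have heq : ∀ (n : ℕ) v, ‖v‖ ≤ n → k n v = κ v := by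
    intro n v hv
    refine le_antisymm (hkle n _ v fun u _ => ?_) (hge n v)
    linarith [le_truncConj hκc u hv]
  have hk0 : ∀ n, k n 0 = 0 := fun n => (heq n 0 (by simp)).trans h0
  obtain ⟨-, ⟨hLi, hLe⟩, ⟨hΦi, hΦe⟩, hJ⟩ := (h.admissible hD hG).J_eq hD hG h.ne_top
  -- Only an upper bound for J is needed, so the l-term keeps the integral of κ_& itself and just
  -- the k-term varies with n.
  refine ⟨k, l, fun n => (∫ x in Ω, k n (F x + wdiv φ₀ x))
    + (∫ u in Λ, (extDown Λ κ u).toReal) + ∫ x in Ω, (legendre f (φ₀.1 x)).toReal,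
    fun n => ⟨(hklip n).continuous.measurable, (hlc n).continuousOn, ?_,
      fun u hu v => hineq n u (subset_closure hu) v⟩, fun n => ?_, ?_⟩
  -- The infimum of l_n is minus its conjugate at 0, and that value is κ(0) = 0.
  · refine ⟨by rintro _ ⟨u, -, rfl⟩; exact hl0 n u, fun b hb => ?_⟩
    have hb' : ∀ u ∈ closure Λ, b ≤ l n u := fun u hu =>
      ContinuousWithinAt.closure_le hu continuousWithinAt_const
        (hlc n).continuousWithinAt fun w hw => hb (mem_image_of_mem _ hw)
    have := hkle n (-b) 0 fun u hu => by
      rw [inner_zero_right]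
      linarith [hb' u hu]
    rw [hk0] at this
    linarith
  · unfold J
    rw [eint_coe ((hklip n).integrable_comp hG), EReal.coe_add, EReal.coe_add]
    refine add_le_add (add_le_add le_rfl ?_) ?_
    · rw [← eint_coe hLi]
      refine eint_mono ?_
      filter_upwards [hD.ae_mem_closure, hLe] with u hu hu'
      rw [hu']
      exact hlext n u hu
    · rw [← eint_coe hΦi]
      exact eint_mono (hΦe.mono fun x hx => hx.ge)
  · rw [hJ]
    refine (continuous_coe_real_ereal.tendsto _).comp ((Tendsto.add_const _ ?_).add_const _)
    refine tendsto_integral_of_dominated_convergence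
      (fun x => R.toNNReal * ‖F x + wdiv φ₀ x‖)
      (fun n => (hklip n).continuous.comp_aestronglyMeasurable hG.1)
      (hG.norm.const_mul _) (fun n => Eventually.of_forall fun x => ?_)
      (Eventually.of_forall fun x => ?_)
    · have := (hklip n).dist_le_mul (F x + wdiv φ₀ x) 0
      rwa [hk0, dist_zero_right, dist_zero_right] at this
    · obtain ⟨N, hN⟩ := exists_nat_ge ‖F x + wdiv φ₀ x‖
      refine tendsto_const_nhds.congr' ?_
      filter_upwards [eventually_ge_atTop N] with n hn
      rw [EReal.toReal_coe, heq n _ (hN.trans (by exact_mod_cast hn))]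

end Continuous

/-! ### The primal problem -/

section Primal

variable {d : ℕ} {Ω Λ : Set (Vec d)} {q R : ℝ} {F : Vec d → Vec d} {f : Mat d → ℝ}
  {S : Set (SobolevPair d Ω q)}

lemma integral_inner_field [Fact (1 ≤ ENNReal.ofReal q)] {u : Vec d → Vec d} (hu : u ∈ US1 Λ S)
    (hD : TransportDomains Ω Λ R) (hF : Integrable F (volume.restrict Ω)) (φ : SobolevPair d Ω q) :
    ∫ x in Ω, ⟪u x, F x + wdiv φ x⟫
      = (∫ x in Ω, ⟪F x, u x⟫) + ∫ x in Ω, ⟪u x, wdiv φ x⟫ := by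
  have := hD.isFiniteMeasure_left
  have hR := US1.ae_norm_le hu hD
  have hm := hu.1.1.aestronglyMeasurable
  simp only [fun x => real_inner_comm (u x) (F x)]
  rw [← integral_add (integrable_inner_of_norm_le hm hR hF)
    (integrable_inner_of_norm_le hm hR (integrable_wdiv φ))]
  simp only [inner_add_right]

lemma pairing_sub_eq [Fact (1 ≤ ENNReal.ofReal q)] {u : Vec d → Vec d} (hu : u ∈ US1 Λ S)
    (hD : TransportDomains Ω Λ R) (hF : Integrable F (volume.restrict Ω))
    {k l : Vec d → EReal} (hA : Admissible Λ k l) {φ : SobolevPair d Ω q}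
    (hJ : J Λ f F k l φ ≠ ⊤) :
    pairing f u φ - ((∫ x in Ω, ⟪F x, u x⟫ : ℝ) : EReal)
      = ((-(∫ x in Ω, ⟪u x, F x + wdiv φ x⟫)
        - ∫ x in Ω, (legendre f (φ.1 x)).toReal : ℝ) : EReal) := by
  have := hD.isFiniteMeasure_left
  obtain ⟨-, -, hφ, -⟩ := hA.J_eq hD (integrable_field hD hF φ) hJ
  have hφe : eint (volume.restrict Ω) (fun x => legendre f (φ.1 x))
      = ((∫ x in Ω, (legendre f (φ.1 x)).toReal : ℝ) : EReal) := by
    rw [← eint_coe hφ.1]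
    exact eint_congr (hφ.2.mono fun x hx => hx.symm)
  rw [pairing_eq hD (integrable_inner_of_norm_le hu.1.1.aestronglyMeasurable
    (US1.ae_norm_le hu hD) (integrable_wdiv φ)), hφe, ← EReal.coe_sub, ← EReal.coe_sub,
    integral_inner_field hu hD hF φ]
  congr 1
  ring

lemma pairing_sub_le_I0 {u : Vec d → Vec d} {φ : SobolevPair d Ω q} (hφ : φ ∈ S) :
    pairing f u φ - ((∫ x in Ω, ⟪F x, u x⟫ : ℝ) : EReal) ≤ I0 f F S u :=
  EReal.sub_le_sub (le_iSup₂ (f := fun φ (_ : φ ∈ S) => pairing f u φ) φ hφ) le_rfl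

/-- Testing the supremum in V_S^f(u) with the φ of the dual triple cancels the f*-terms and leaves
the integrated inequality for k and l. -/
lemma neg_J_le_I0 [Fact (1 ≤ ENNReal.ofReal q)] {u : Vec d → Vec d} (hu : u ∈ US1 Λ S)
    (hD : TransportDomains Ω Λ R) (hF : Integrable F (volume.restrict Ω))
    {k l : Vec d → EReal} (hA : Admissible Λ k l) {φ : SobolevPair d Ω q} (hφ : φ ∈ S) :
    -J Λ f F k l φ ≤ I0 f F S u := by
  by_cases hJ : J Λ f F k l φ = ⊤
  · rw [hJ, EReal.neg_top]; exact bot_le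
  refine le_trans ?_ (pairing_sub_le_I0 hφ)
  have hG := integrable_field hD hF φ
  rw [pairing_sub_eq hu hD hF hA hJ, (hA.J_eq hD hG hJ).2.2.2, ← EReal.coe_neg,
    EReal.coe_le_coe_iff]
  linarith [(US1.integral_inner_le hu hD hA hG hJ).1]

namespace IsDualOptimizer

variable [Fact (1 ≤ ENNReal.ofReal q)] {κ : Vec d → ℝ} {φ₀ : SobolevPair d Ω q}

lemma I0_eq (h : IsDualOptimizer Λ f F S κ φ₀) (hD : TransportDomains Ω Λ R)
    (hF : Integrable F (volume.restrict Ω)) {u₀ : Vec d → Vec d} (hu₀ : u₀ ∈ US1 Λ S)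
    (hΦ : φ₀ ∈ PhiS f S u₀)
    (hgrad : ∀ᵐ x ∂volume.restrict Ω, HasGradientAt κ (u₀ x) (F x + wdiv φ₀ x)) :
    I0 f F S u₀ = -J Λ f F (fun v => (κ v : EReal)) (extDown Λ κ) φ₀ := by
  have hG := integrable_field hD hF φ₀
  have hA := h.admissible hD hG
  refine le_antisymm ?_ (neg_J_le_I0 hu₀ hD hF hA h.mem)
  have hV : VS f S u₀ ≤ pairing f u₀ φ₀ := iSup₂_le hΦ.2
  refine (EReal.sub_le_sub hV le_rfl).trans ?_
  obtain ⟨⟨hk, -⟩, ⟨hl, -⟩, -, hJ⟩ := hA.J_eq hD hG h.ne_top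
  rw [pairing_sub_eq hu₀ hD hF hA h.ne_top, hJ, ← EReal.coe_neg, EReal.coe_le_coe_iff]
  have hmap := US1.map_eq hu₀ hD
  rw [← hmap] at hl ⊢
  have hlu : Integrable (fun x => (extDown Λ κ (u₀ x)).toReal) (volume.restrict Ω) :=
    hl.comp_aemeasurable hu₀.1.1
  rw [integral_map hu₀.1.1 hl.1, ← integral_add hk hlu]
  refine le_of_eq ?_
  rw [neg_add, sub_eq_add_neg]
  congr 2
  refine integral_congr_ae ?_
  filter_upwards [hgrad] with x hx
  have he := (h.mem_closure_and_add_eq hx).2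
  have htop : extDown Λ κ (u₀ x) ≠ ⊤ := fun ht => by
    rw [ht, EReal.coe_add_top] at he
    exact EReal.coe_ne_top _ he.symm
  rw [← EReal.coe_toReal htop (extDown_ne_bot κ _), ← EReal.coe_add, EReal.coe_eq_coe_iff] at he
  rw [EReal.toReal_coe, he]

/-- Attaining the dual value forces equality in weak duality, hence the pointwise Fenchel equality,
whose only solution at a differentiability point is the gradient. -/
lemma ae_eq_of_I0_le (h : IsDualOptimizer Λ f F S κ φ₀) (hD : TransportDomains Ω Λ R)
    (hF : Integrable F (volume.restrict Ω)) {u₀ u₁ : Vec d → Vec d} (hu₁ : u₁ ∈ US1 Λ S)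
    (hgrad : ∀ᵐ x ∂volume.restrict Ω, HasGradientAt κ (u₀ x) (F x + wdiv φ₀ x))
    (hle : I0 f F S u₁ ≤ -J Λ f F (fun v => (κ v : EReal)) (extDown Λ κ) φ₀) :
    u₁ =ᵐ[volume.restrict Ω] u₀ := by
  have hG := integrable_field hD hF φ₀
  have hA := h.admissible hD hG
  have h1 := (pairing_sub_le_I0 h.mem).trans hle
  rw [pairing_sub_eq hu₁ hD hF hA h.ne_top, (hA.J_eq hD hG h.ne_top).2.2.2, ← EReal.coe_neg,
    EReal.coe_le_coe_iff] at h1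
  filter_upwards [(US1.integral_inner_le hu₁ hD hA hG h.ne_top).2 (by linarith), hgrad,
    hu₁.1.2.1] with x hx hx' hmem
  exact h.conj.eq_of_le (extDown_ne_bot κ) hx' hmem hx.le

end IsDualOptimizer

end Primal

/-! ### The main theorem -/

lemma transportDomains_of_convex {d : ℕ} {Ω Λ : Set (Vec d)} {r : ℝ} (hΩo : IsOpen Ω)
    (hΩb : Bornology.IsBounded Ω) (hΛc : Convex ℝ Λ) (hr : 1 < r)
    (hΛr : Metric.ball (0 : Vec d) (1 / r) ⊆ Λ) (hΛR : Λ ⊆ Metric.ball (0 : Vec d) (r / 2))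
    (hvol : volume Ω = volume Λ) : TransportDomains Ω Λ r where
  measurableSet := hΩo.measurableSet
  volume_ne_top := hΩb.measure_lt_top.ne
  volume_ne_zero := by
    rw [hvol]
    exact ((Metric.measure_ball_pos volume _ (by positivity)).trans_le (measure_mono hΛr)).ne'
  volume_eq := hvol
  restrict_closure := Measure.restrict_congr_set (by
    have h0 : volume (closure Λ \ Λ) = 0 := by
      -- Convexity enters here: the frontier of a convex set is Lebesgue null.
      refine measure_mono_null ?_ (hΛc.addHaar_frontier volume)
      exact sdiff_subset_sdiff_right interior_subset
    exact (ae_eq_set.2 ⟨by rw [sdiff_eq_empty.2 subset_closure, measure_empty], h0⟩))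
  norm_le u hu := by
    have h1 : closure Λ ⊆ Metric.closedBall 0 (r / 2) :=
      closure_minimal (hΛR.trans Metric.ball_subset_closedBall) Metric.isClosed_closedBall
    have := mem_closedBall_zero_iff.1 (h1 hu)
    linarith
  nonneg := by linarith

end

theorem theorem4p3 (d : ℕ) (Ω Λ : Set (Vec d)) (r p q : ℝ)
    (hΩo : IsOpen Ω) (hΩc : Convex ℝ Ω) (hΩb : Bornology.IsBounded Ω)
    (hΛc : Convex ℝ Λ) (hr : 1 < r)
    (hΛr : Metric.ball (0 : Vec d) (1 / r) ⊆ Λ) (hΛR : Λ ⊆ Metric.ball (0 : Vec d) (r / 2))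
    (hvol : volume Ω = volume Λ)
    (hpq : p.HolderConjugate q) [Fact (1 ≤ ENNReal.ofReal q)]
    (f : Mat d → ℝ) (F : Vec d → Vec d) (S : Set (SobolevPair d Ω q))
    (hS : S ⊆ W0 d Ω q) (hSne : S.Nonempty) (hScl : IsClosed S) (hScv : Convex ℝ S)
    (hSfin : FiniteDimensional ℝ (Submodule.span ℝ S))
    (hf : IntegrandAssumption p q f S)
    (hF : IntegrableOn F Ω volume)
    (hND : ∀ φ ∈ S, Nondegenerate Ω (fun x => F x + wdiv φ x)) :
    -- duality: the infimum of the primal problem is minus the infimum of the dual problem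
    (∃ m : ℝ, sInf (I0 f F S '' US1 Λ S) = ((m : ℝ) : EReal) ∧
      sInf {j : EReal | ∃ k l : Vec d → EReal, ∃ φ ∈ S, Admissible Λ k l ∧ j = J Λ f F k l φ}
        = ((-m : ℝ) : EReal) ∧
      sInf {j : EReal | ∃ k l : Vec d → ℝ, ∃ φ ∈ S, ContAdmissible Λ k l ∧
          j = J Λ f F (fun v => (k v : EReal)) (fun u => (l u : EReal)) φ}
        = ((-m : ℝ) : EReal)) ∧
    ∃ (k₀ : Vec d → ℝ) (l₀ : Vec d → EReal) (φ₀ : SobolevPair d Ω q) (u₀ : Vec d → Vec d),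
      -- the dual problem has the optimizer `(k₀, l₀, φ₀)`
      (φ₀ ∈ S ∧ Admissible Λ (fun v => (k₀ v : EReal)) l₀ ∧
        (∀ k l : Vec d → EReal, ∀ φ ∈ S, Admissible Λ k l →
          J Λ f F (fun v => (k₀ v : EReal)) l₀ φ₀ ≤ J Λ f F k l φ)) ∧
      (∀ v, (k₀ v : EReal) = conjUp Λ l₀ v) ∧
      (∀ u ∈ closure Λ, l₀ u = conjDown (fun v => (k₀ v : EReal)) u) ∧
      ConvexOn ℝ univ k₀ ∧ LipschitzWith (Real.toNNReal r) k₀ ∧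
      -- the primal problem has the unique minimizer `u₀`
      (u₀ ∈ US1 Λ S ∧ ∀ u ∈ US1 Λ S, I0 f F S u₀ ≤ I0 f F S u) ∧
      (∀ u₁ ∈ US1 Λ S, (∀ u ∈ US1 Λ S, I0 f F S u₁ ≤ I0 f F S u) →
        u₁ =ᵐ[volume.restrict Ω] u₀) ∧
      -- `u₀ = ∇k₀(F + div φ₀)` and `φ₀ ∈ Φ_S(u₀)`
      (∀ᵐ x ∂volume.restrict Ω, HasGradientAt k₀ (u₀ x) (F x + wdiv φ₀ x)) ∧
      φ₀ ∈ PhiS f S u₀ := by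
  have hD := transportDomains_of_convex hΩo hΩb hΛc hr hΛr hΛR hvol
  have hΛne : Λ.Nonempty := ⟨0, hΛr (Metric.mem_ball_self (by positivity))⟩
  obtain ⟨a, b, c, -, -, hc, hgrowth, -⟩ := hf.growth
  have hsuper := legendre_superlinear (f := f) hpq.pos hc fun ξ => (hgrowth ξ).1
  obtain ⟨κ, φ₀, hopt, hκ0⟩ := exists_isDualOptimizer hD hF hS hScl hsuper hf.nonempty
  have hG := integrable_field hD hF φ₀
  have hA := hopt.admissible hD hG
  obtain ⟨u₀, hu₀m, hgrad⟩ := hopt.exists_gradient hD hF (hND φ₀ hopt.mem)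
  have hu₀ : u₀ ∈ US1 Λ S := hopt.mem_US1 hD hF hS hu₀m hgrad
  have hΦ : φ₀ ∈ PhiS f S u₀ :=
    hopt.mem_PhiS hD hF hScv hu₀m (US1.ae_norm_le hu₀ hD) hgrad
  have hI := hopt.I0_eq hD hF hu₀ hΦ hgrad
  have hmin : ∀ u ∈ US1 Λ S, I0 f F S u₀ ≤ I0 f F S u := fun u hu =>
    hI.le.trans (neg_J_le_I0 hu hD hF hA hopt.mem)
  obtain ⟨j, hj⟩ : ∃ j : ℝ, J Λ f F (fun v => (κ v : EReal)) (extDown Λ κ) φ₀ = (j : EReal) :=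
    ⟨_, (hA.J_eq hD hG hopt.ne_top).2.2.2⟩
  refine ⟨⟨-j, ?_, ?_, ?_⟩, κ, extDown Λ κ, φ₀, u₀, ⟨hopt.mem, hA, hopt.le⟩, hopt.conj,
    fun u hu => extDown_of_mem hu, hopt.conj.convexOn (extDown_ne_bot κ), hopt.lipschitzWith hD,
    ⟨hu₀, hmin⟩, fun u₁ hu₁ hu₁min => ?_, hgrad, hΦ⟩
  · rw [EReal.coe_neg, ← hj, ← hI]
    exact le_antisymm (sInf_le (mem_image_of_mem _ hu₀))
      (le_sInf (by rintro _ ⟨u, hu, rfl⟩; exact hmin u hu))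
  · rw [neg_neg, ← hj]
    exact le_antisymm (sInf_le ⟨_, _, φ₀, hopt.mem, hA, rfl⟩)
      (le_sInf (by rintro _ ⟨k, l, φ, hφ, hkl, rfl⟩; exact hopt.le k l φ hφ hkl))
  · rw [neg_neg, ← hj]
    refine le_antisymm ?_ (le_sInf ?_)
    -- The infimum over continuous potentials need not be attained; it is bounded by every c_n and
    -- hence by their limit.
    · obtain ⟨k, l, c, hkl, hle, hlim⟩ := hopt.exists_contAdmissible hκ0 hD hΛne hG
      exact ge_of_tendsto' hlim fun n =>
        le_trans (sInf_le ⟨k n, l n, φ₀, hopt.mem, hkl n, rfl⟩) (hle n)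
    · rintro _ ⟨k, l, φ, hφ, hkl, rfl⟩
      rw [← J_extTop hD]
      exact hopt.le _ _ φ hφ (hkl.admissible_extTop hΛne)
  · exact hopt.ae_eq_of_I0_le hD hF hu₁ hgrad ((hu₁min u₀ hu₀).trans hI.le)
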